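/- Let $0\le m\le n$ be integers and let $\mathcal M$ be the set of pairs $(Q,P)$ of real $n\times m$ matrices, both of rank $m$. Put $j_L(Q,P)=QP^\top\in\mathfrak{gl}(n,\mathbb R)$ and $j_R(Q,P)=P^\top Q\in\mathfrak{gl}(m,\mathbb R)$ for $(Q,P)\in\mathcal M$. The adjoint orbit of $X\in\mathfrak{gl}(k,\mathbb R)$ is $\mathcal O_X=\{AXA^{-1}: A\in GL(k,\mathbb R)\}$. A real Jordan datum consists of integers $p,q$ with $0\le p\le m$ and $0\le q\le\min\{m,n-m\}$; non-zero complex numbers $\lambda_1,\dots,\lambda_p$ with $\operatorname{Im}\lambda_i\ge 0$; and integers $c_i\ge 1$ ($1\le i\le p$), with $c_i$ even if $\operatorname{Im}\lambda_i>0$, and $d_j\ge 2$ ($1\le j\le q$), such that $$\sum_{i=1}^p c_i+\sum_{j=1}^q (d_j-1)=m .$$ Let $J_c(\lambda)$ denote the real $c\times c$ Jordan block: for real $\lambda$ it has $\lambda$ on the diagonal, $1$ on the superdiagonal and $0$ elsewhere (so $J_1(0)$ is the $1\times 1$ zero matrix); for $\lambda=a+ib$ with $b>0$ and $c$ even it consists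 of $2\times 2$ blocks, with $\begin{bmatrix}a&b\\-b&a\end{bmatrix}$ on the diagonal, the identity on the block superdiagonal and $0$ elsewhere. To a real Jordan datum associate the block diagonal matrices $$\zeta=\operatorname{diag}\bigl(J_{c_1}(\lambda_1),\dots,J_{c_p}(\lambda_p),J_{d_1}(0),\dots,J_{d_q}(0),0_{(n-m-q)\times(n-m-q)}\bigr)\in\mathfrak{gl}(n,\mathbb R),$$ $$\xi=\operatorname{diag}\bigl(J_{c_1}(\lambda_1),\dots,J_{c_p}(\lambda_p),J_{d_1-1}(0),\dots,J_{d_q-1}(0)\bigr)\in\mathfrak{gl}(m,\mathbb R).$$ Then the following hold. 1. The map sending a real Jordan datum to $\mathcal O_\zeta$ induces a bijection from real Jordan data, up to reordering of the pairs $(\lambda_i,c_i)$ and of the $d_j$, onto the set of adjoint orbits contained in $j_L(\mathcal M)$. 2. Likewise, the map sending a real Jordan datum to $\mathcal O_\xi$ induces a bijection from real Jordan data, up to the same reordering, onto the set of adjoint orbits contained in $j_R(\mathcal M)$. 3. The images $j_L(\mathcal M)$ and $j_R(\mathcal M)$ are unions of adjoint orbits, and $\mathcal O\mapsto j_R(j_L^{-1}(\mathcal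 O))$ is a one-to-one correspondence between the adjoint orbits in $j_L(\mathcal M)$ and those in $j_R(\mathcal M)$. It sends $\mathcal O_{j_L(Q,P)}$ to $\mathcal O_{j_R(Q,P)}$ for every $(Q,P)\in\mathcal M$, and for every real Jordan datum it sends $\mathcal O_\zeta$ to $\mathcal O_\xi$. -/

import Mathlib

open Matrix

noncomputable section

namespace DualPair

/-- The space of pairs `(Q, P)` of real `n × m` matrices, both of rank `m`. -/
def fullRankPairs (n m : ℕ) :
    Set (Matrix (Fin n) (Fin m) ℝ × Matrix (Fin n) (Fin m) ℝ) :=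
  {x | x.1.rank = m ∧ x.2.rank = m}

/-- The left momentum map `j_L(Q, P) = Q Pᵀ`. -/
def jL {n m : ℕ} (x : Matrix (Fin n) (Fin m) ℝ × Matrix (Fin n) (Fin m) ℝ) :
    Matrix (Fin n) (Fin n) ℝ :=
  x.1 * x.2ᵀ

/-- The right momentum map `j_R(Q, P) = Pᵀ Q`. -/
def jR {n m : ℕ} (x : Matrix (Fin n) (Fin m) ℝ × Matrix (Fin n) (Fin m) ℝ) :
    Matrix (Fin m) (Fin m) ℝ :=
  x.2ᵀ * x.1

/-- The image of `j_L` on pairs of full-rank matrices. -/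
def imageL (n m : ℕ) : Set (Matrix (Fin n) (Fin n) ℝ) :=
  jL '' fullRankPairs n m

/-- The image of `j_R` on pairs of full-rank matrices. -/
def imageR (n m : ℕ) : Set (Matrix (Fin m) (Fin m) ℝ) :=
  jR '' fullRankPairs n m

/-- The adjoint orbit `{A X A⁻¹ | A ∈ GL(k, ℝ)}` of a matrix `X ∈ gl(k, ℝ)`. -/
def adjointOrbit {k : ℕ} (X : Matrix (Fin k) (Fin k) ℝ) : Set (Matrix (Fin k) (Fin k) ℝ) :=
  Set.range fun A : GL (Fin k) ℝ =>
    (A : Matrix (Fin k) (Fin k) ℝ) * X * ((A⁻¹ : GL (Fin k) ℝ) : Matrix (Fin k) (Fin k) ℝ)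

/-- The adjoint orbits that lie in a given subset `S` of `gl(k, ℝ)`. -/
def orbitsIn {k : ℕ} (S : Set (Matrix (Fin k) (Fin k) ℝ)) :
    Set (Set (Matrix (Fin k) (Fin k) ℝ)) :=
  {O | (∃ X, O = adjointOrbit X) ∧ O ⊆ S}

/-- The correspondence `O ↦ j_R (j_L⁻¹ (O))`, where `j_L` and `j_R` are restricted to pairs of
full-rank matrices. -/
def orbitCorrespondence (n m : ℕ) (O : Set (Matrix (Fin n) (Fin n) ℝ)) :
    Set (Matrix (Fin m) (Fin m) ℝ) :=
  jR '' {x | x ∈ fullRankPairs n m ∧ jL x ∈ O}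

/-- The real Jordan block of size `c × c` with generalised eigenvalue `l`.
If `l` is real it is the usual block, with `l` on the diagonal and `1` on the superdiagonal.
If `l = a + i b` with `b ≠ 0` (used for even `c` only) it consists of `2 × 2` blocks, with
`[a, b; -b, a]` on the diagonal and the identity on the block superdiagonal. -/
def realJordanBlock (c : ℕ) (l : ℂ) : Matrix (Fin c) (Fin c) ℝ :=
  if l.im = 0 then
    Matrix.of fun i j =>
      if i = j then l.re
      else if (i : ℕ) + 1 = j then 1
      else 0
  else
    Matrix.of fun i j =>
      if (i : ℕ) / 2 = (j : ℕ) / 2 then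
        (if i = j then l.re else if i < j then l.im else -l.im)
      else if (i : ℕ) + 2 = j then 1
      else 0

/-- Real Jordan data for the pair `(n, m)`. The inequality `q ≤ min {m, n - m}` is one between
integers. -/
structure JordanData (n m : ℕ) where
  p : ℕ
  q : ℕ
  lam : Fin p → ℂ
  c : Fin p → ℕ
  d : Fin q → ℕ
  p_le : p ≤ m
  q_le : (q : ℤ) ≤ min (m : ℤ) ((n : ℤ) - (m : ℤ))
  lam_ne_zero : ∀ i, lam i ≠ 0
  lam_im_nonneg : ∀ i, 0 ≤ (lam i).im
  one_le_c : ∀ i, 1 ≤ c i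
  even_c : ∀ i, 0 < (lam i).im → Even (c i)
  two_le_d : ∀ j, 2 ≤ d j
  sum_eq : ∑ i, c i + ∑ j, (d j - 1) = m

namespace JordanData

variable {n m : ℕ}

/-- Two Jordan data agree up to the order of the pairs `(λ_i, c_i)` and of the `d_j`. -/
def SameUpToOrder (D D' : JordanData n m) : Prop :=
  (∃ σ : Fin D.p ≃ Fin D'.p, ∀ i, D'.lam (σ i) = D.lam i ∧ D'.c (σ i) = D.c i) ∧
    ∃ τ : Fin D.q ≃ Fin D'.q, ∀ j, D'.d (τ j) = D.d j

theorem sum_d_eq (D : JordanData n m) : ∑ j, D.d j = ∑ j, (D.d j - 1) + D.q := by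
  have h : ∑ j, D.d j = ∑ j, ((D.d j - 1) + 1) :=
    Finset.sum_congr rfl fun j _ => by
      have := D.two_le_d j
      omega
  rw [h, Finset.sum_add_distrib]
  simp

theorem size_eq (D : JordanData n m) :
    ∑ i, D.c i + (∑ j, D.d j + (n - m - D.q)) = n := by
  have h1 := D.sum_d_eq
  have h2 := D.sum_eq
  have h3 := D.q_le
  omega

/-- The lexicographic identification of the index set of the blocks of sizes
`c_1, …, c_p, d_1, …, d_q, n - m - q` with `{0, …, n - 1}`. -/
def zetaIndex (D : JordanData n m) :
    ((Σ i, Fin (D.c i)) ⊕ ((Σ j, Fin (D.d j)) ⊕ Fin (n - m - D.q))) ≃ Fin n :=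
  ((Equiv.sumCongr finSigmaFinEquiv
    ((Equiv.sumCongr finSigmaFinEquiv (Equiv.refl _)).trans finSumFinEquiv)).trans
      finSumFinEquiv).trans (finCongr D.size_eq)

/-- The lexicographic identification of the index set of the blocks of sizes
`c_1, …, c_p, d_1 - 1, …, d_q - 1` with `{0, …, m - 1}`. -/
def xiIndex (D : JordanData n m) :
    ((Σ i, Fin (D.c i)) ⊕ (Σ j, Fin (D.d j - 1))) ≃ Fin m :=
  ((Equiv.sumCongr finSigmaFinEquiv finSigmaFinEquiv).trans finSumFinEquiv).trans
    (finCongr D.sum_eq)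

/-- The block diagonal matrix with blocks
`J_{c_1}(λ_1), …, J_{c_p}(λ_p), J_{d_1}(0), …, J_{d_q}(0)` and a zero block of size
`n - m - q`, as an element of `gl(n, ℝ)`. -/
def zeta (D : JordanData n m) : Matrix (Fin n) (Fin n) ℝ :=
  Matrix.reindex D.zetaIndex D.zetaIndex
    (Matrix.fromBlocks
      (Matrix.blockDiagonal' fun i => realJordanBlock (D.c i) (D.lam i)) 0
      0 (Matrix.fromBlocks
          (Matrix.blockDiagonal' fun j => realJordanBlock (D.d j) 0) 0
          0 0))

/-- The block diagonal matrix with blocks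
`J_{c_1}(λ_1), …, J_{c_p}(λ_p), J_{d_1 - 1}(0), …, J_{d_q - 1}(0)`, as an element of
`gl(m, ℝ)`. -/
def xi (D : JordanData n m) : Matrix (Fin m) (Fin m) ℝ :=
  Matrix.reindex D.xiIndex D.xiIndex
    (Matrix.fromBlocks
      (Matrix.blockDiagonal' fun i => realJordanBlock (D.c i) (D.lam i)) 0
      0 (Matrix.blockDiagonal' fun j => realJordanBlock (D.d j - 1) 0))

end JordanData

end DualPair

end

namespace DualPair

/-! ### Full rank and one-sided inverses -/

section FullRank

/-! The groups GL(n) and GL(m) act on the full-rank pairs by `(Q, P) ↦ (AQ, A⁻ᵀP)` and `(Q, P) ↦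
(QB⁻¹, PBᵀ)`. Each momentum map is equivariant for one action and invariant under the other. The
one-sided inverses supplied by full rank show that pairs with equal `QPᵀ` have conjugate `PᵀQ`
(`jR_mem_adjointOrbit_of_jL_eq`), so the correspondence sends an orbit to a single orbit
(`orbitCorrespondence_adjointOrbit_jL`).

The shift from `d` to `d - 1` comes from factoring a nilpotent block through dimension `d - 1`: one
order of the factors gives `J_d(0)`, the other `J_{d-1}(0)`. Invertible blocks factor trivially as
`1 * J`. Hence `zeta` and `xi` are the two momenta of one full-rank pair (`jL_pair`, `jR_pair`).

The rest is the real Jordan classification, read as the structure theory of torsion `ℝ[X]`-modules: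
`mem_adjointOrbit_iff_nonempty_equiv` translates conjugacy, `exists_polyModule_equiv_jordanModule`
gives existence and `exists_equiv_of_jordanModule_equiv` uniqueness. A matrix in the image of `j_L`
has rank `m`, so exactly `n - m` of its blocks have eigenvalue zero, which is the numerical
condition on a datum. Existence is proved only for `zeta` and uniqueness only for `xi`; the
correspondence carries each to the other side. -/

theorem isUnit_of_rank_eq_card {k : Type*} [Fintype k] [DecidableEq k] {A : Matrix k k ℝ}
    (h : A.rank = Fintype.card k) : IsUnit A := by
  rw [← Matrix.mulVec_surjective_iff_isUnit]
  have h1 : LinearMap.range A.mulVecLin = ⊤ := by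
    apply Submodule.eq_top_of_finrank_eq
    rw [Module.finrank_fintype_fun_eq_card]
    exact h
  exact LinearMap.range_eq_top.mp h1

/-- A real matrix has full column rank if and only if it has a left inverse. -/
theorem rank_eq_card_iff_exists_mul_eq_one {k l : Type*} [Fintype k] [Fintype l] [DecidableEq l]
    (Q : Matrix k l ℝ) : Q.rank = Fintype.card l ↔ ∃ L : Matrix l k ℝ, L * Q = 1 := by
  constructor
  · intro h
    -- Over the reals the Gram matrix has the rank of `Q`, so full column rank makes it invertible.
    have hu : IsUnit (Qᵀ * Q) := isUnit_of_rank_eq_card (by rw [rank_transpose_mul_self, h])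
    refine ⟨(Qᵀ * Q)⁻¹ * Qᵀ, ?_⟩
    rw [Matrix.mul_assoc]
    exact Matrix.nonsing_inv_mul _ ((Matrix.isUnit_iff_isUnit_det _).mp hu)
  · rintro ⟨L, hL⟩
    refine le_antisymm (Matrix.rank_le_card_width _) ?_
    rw [← Matrix.rank_one (R := ℝ) (n := l), ← hL]
    exact Matrix.rank_mul_le_right _ _

variable {n m : ℕ}

theorem mem_fullRankPairs_iff {x : Matrix (Fin n) (Fin m) ℝ × Matrix (Fin n) (Fin m) ℝ} :
    x ∈ fullRankPairs n m ↔
      (∃ L : Matrix (Fin m) (Fin n) ℝ, L * x.1 = 1) ∧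
        ∃ R : Matrix (Fin n) (Fin m) ℝ, x.2ᵀ * R = 1 := by
  have h1 := rank_eq_card_iff_exists_mul_eq_one x.1
  have h2 := rank_eq_card_iff_exists_mul_eq_one x.2
  rw [Fintype.card_fin] at h1 h2
  refine and_congr h1 (h2.trans ⟨?_, ?_⟩)
  · rintro ⟨L, hL⟩
    exact ⟨Lᵀ, by rw [← Matrix.transpose_mul, hL, Matrix.transpose_one]⟩
  · rintro ⟨R, hR⟩
    exact ⟨Rᵀ, by
      rw [← Matrix.transpose_transpose x.2, ← Matrix.transpose_mul, hR, Matrix.transpose_one]⟩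

/-- A left inverse of `Q` recovers `Pᵀ` from `QPᵀ`, so the product loses no rank. -/
theorem rank_of_mem_imageL {X : Matrix (Fin n) (Fin n) ℝ} (hX : X ∈ imageL n m) : X.rank = m := by
  obtain ⟨x, hx, rfl⟩ := hX
  obtain ⟨L, hL⟩ := (mem_fullRankPairs_iff.mp hx).1
  have hP : x.2ᵀ.rank = m := by rw [Matrix.rank_transpose]; exact hx.2
  apply le_antisymm
  · exact (Matrix.rank_mul_le_right _ _).trans hP.le
  · have h : L * jL x = x.2ᵀ := by rw [jL, ← Matrix.mul_assoc, hL, Matrix.one_mul]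
    calc m = (L * jL x).rank := by rw [h, hP]
      _ ≤ (jL x).rank := Matrix.rank_mul_le_right _ _

end FullRank

/-! ### Conjugacy as an equivalence relation -/

section Orbits

variable {k : ℕ}

theorem mem_adjointOrbit_iff {X Y : Matrix (Fin k) (Fin k) ℝ} :
    Y ∈ adjointOrbit X ↔ ∃ A B : Matrix (Fin k) (Fin k) ℝ, A * B = 1 ∧ Y = A * X * B := by
  constructor
  · rintro ⟨A, rfl⟩
    exact ⟨A, _, A.mul_inv, rfl⟩
  · rintro ⟨A, B, h, rfl⟩
    exact ⟨⟨A, B, h, mul_eq_one_comm.mp h⟩, rfl⟩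

theorem self_mem_adjointOrbit (X : Matrix (Fin k) (Fin k) ℝ) : X ∈ adjointOrbit X :=
  mem_adjointOrbit_iff.mpr ⟨1, 1, by simp, by simp⟩

theorem adjointOrbit_symm {X Y : Matrix (Fin k) (Fin k) ℝ} (h : Y ∈ adjointOrbit X) :
    X ∈ adjointOrbit Y := by
  obtain ⟨A, B, hAB, rfl⟩ := mem_adjointOrbit_iff.mp h
  have hBA : B * A = 1 := mul_eq_one_comm.mp hAB
  refine mem_adjointOrbit_iff.mpr ⟨B, A, hBA, ?_⟩
  simp only [Matrix.mul_assoc, hBA, Matrix.mul_one]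
  rw [← Matrix.mul_assoc, hBA, Matrix.one_mul]

theorem adjointOrbit_trans {X Y Z : Matrix (Fin k) (Fin k) ℝ} (h : Y ∈ adjointOrbit X)
    (h' : Z ∈ adjointOrbit Y) : Z ∈ adjointOrbit X := by
  obtain ⟨A, B, hAB, rfl⟩ := mem_adjointOrbit_iff.mp h
  obtain ⟨A', B', hAB', rfl⟩ := mem_adjointOrbit_iff.mp h'
  refine mem_adjointOrbit_iff.mpr ⟨A' * A, B * B', ?_, by simp only [Matrix.mul_assoc]⟩
  rw [Matrix.mul_assoc, ← Matrix.mul_assoc A, hAB, Matrix.one_mul, hAB']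

theorem adjointOrbit_eq_iff {X Y : Matrix (Fin k) (Fin k) ℝ} :
    adjointOrbit X = adjointOrbit Y ↔ Y ∈ adjointOrbit X := by
  constructor
  · intro h
    rw [h]
    exact self_mem_adjointOrbit Y
  · intro h
    ext Z
    exact ⟨adjointOrbit_trans (adjointOrbit_symm h), adjointOrbit_trans h⟩

end Orbits

/-! ### The two commuting actions and the orbit correspondence -/

section Correspondence

variable {n m : ℕ} {x : Matrix (Fin n) (Fin m) ℝ × Matrix (Fin n) (Fin m) ℝ}

theorem left_mul_mem_fullRankPairs {A B : Matrix (Fin n) (Fin n) ℝ} (hBA : B * A = 1)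
    (hx : x ∈ fullRankPairs n m) : (A * x.1, Bᵀ * x.2) ∈ fullRankPairs n m := by
  obtain ⟨⟨L, hL⟩, R, hR⟩ := mem_fullRankPairs_iff.mp hx
  refine mem_fullRankPairs_iff.mpr ⟨⟨L * B, ?_⟩, A * R, ?_⟩
  · change L * B * (A * x.1) = 1
    rw [Matrix.mul_assoc, ← Matrix.mul_assoc B, hBA, Matrix.one_mul, hL]
  · change (Bᵀ * x.2)ᵀ * (A * R) = 1
    rw [Matrix.transpose_mul, Matrix.transpose_transpose, Matrix.mul_assoc, ← Matrix.mul_assoc B,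
      hBA, Matrix.one_mul, hR]

theorem jL_left_mul (A B : Matrix (Fin n) (Fin n) ℝ) :
    jL (A * x.1, Bᵀ * x.2) = A * jL x * B := by
  simp only [jL, Matrix.transpose_mul, Matrix.transpose_transpose, Matrix.mul_assoc]

theorem jR_left_mul {A B : Matrix (Fin n) (Fin n) ℝ} (hBA : B * A = 1) :
    jR (A * x.1, Bᵀ * x.2) = jR x := by
  simp only [jR, Matrix.transpose_mul, Matrix.transpose_transpose]
  rw [Matrix.mul_assoc, ← Matrix.mul_assoc B, hBA, Matrix.one_mul]

theorem mul_right_mem_fullRankPairs {A B : Matrix (Fin m) (Fin m) ℝ} (hAB : A * B = 1)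
    (hx : x ∈ fullRankPairs n m) : (x.1 * B, x.2 * Aᵀ) ∈ fullRankPairs n m := by
  obtain ⟨⟨L, hL⟩, R, hR⟩ := mem_fullRankPairs_iff.mp hx
  refine mem_fullRankPairs_iff.mpr ⟨⟨A * L, ?_⟩, R * B, ?_⟩
  · change A * L * (x.1 * B) = 1
    rw [Matrix.mul_assoc, ← Matrix.mul_assoc L, hL, Matrix.one_mul, hAB]
  · change (x.2 * Aᵀ)ᵀ * (R * B) = 1
    rw [Matrix.transpose_mul, Matrix.transpose_transpose, Matrix.mul_assoc, ← Matrix.mul_assoc _ R,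
      hR, Matrix.one_mul, hAB]

theorem jL_mul_right {A B : Matrix (Fin m) (Fin m) ℝ} (hBA : B * A = 1) :
    jL (x.1 * B, x.2 * Aᵀ) = jL x := by
  simp only [jL, Matrix.transpose_mul, Matrix.transpose_transpose]
  rw [Matrix.mul_assoc, ← Matrix.mul_assoc B, hBA, Matrix.one_mul]

theorem jR_mul_right (A B : Matrix (Fin m) (Fin m) ℝ) :
    jR (x.1 * B, x.2 * Aᵀ) = A * jR x * B := by
  simp only [jR, Matrix.transpose_mul, Matrix.transpose_transpose, Matrix.mul_assoc]

theorem adjointOrbit_jL_mem_orbitsIn (hx : x ∈ fullRankPairs n m) :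
    adjointOrbit (jL x) ∈ orbitsIn (imageL n m) := by
  refine ⟨⟨_, rfl⟩, ?_⟩
  intro Y hY
  obtain ⟨A, B, hAB, rfl⟩ := mem_adjointOrbit_iff.mp hY
  exact ⟨_, left_mul_mem_fullRankPairs (mul_eq_one_comm.mp hAB) hx, jL_left_mul A B⟩

theorem adjointOrbit_jR_mem_orbitsIn (hx : x ∈ fullRankPairs n m) :
    adjointOrbit (jR x) ∈ orbitsIn (imageR n m) := by
  refine ⟨⟨_, rfl⟩, ?_⟩
  intro Y hY
  obtain ⟨A, B, hAB, rfl⟩ := mem_adjointOrbit_iff.mp hY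
  exact ⟨_, mul_right_mem_fullRankPairs hAB hx, jR_mul_right A B⟩

/-- Pairs of full-rank matrices with the same left momentum have conjugate right momenta. -/
theorem jR_mem_adjointOrbit_of_jL_eq
    {y : Matrix (Fin n) (Fin m) ℝ × Matrix (Fin n) (Fin m) ℝ} (hx : x ∈ fullRankPairs n m)
    (h : jL x = jL y) : jR x ∈ adjointOrbit (jR y) := by
  obtain ⟨⟨L, hL⟩, R, hR⟩ := mem_fullRankPairs_iff.mp hx
  obtain ⟨Q, P⟩ := x
  obtain ⟨Q', P'⟩ := y
  simp only [jL, jR] at *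
  -- Cancelling `Q` on the left and `Pᵀ` on the right of `QPᵀ = Q'P'ᵀ` expresses the first pair
  -- through the second; the conjugating matrices `LQ'` and `P'ᵀR` appear as the factors.
  have hP : Pᵀ = L * Q' * P'ᵀ := by
    rw [Matrix.mul_assoc, ← h, ← Matrix.mul_assoc, hL, Matrix.one_mul]
  have hQ : Q = Q' * (P'ᵀ * R) := by
    rw [← Matrix.mul_assoc, ← h, Matrix.mul_assoc, hR, Matrix.mul_one]
  refine mem_adjointOrbit_iff.mpr ⟨L * Q', P'ᵀ * R, ?_, ?_⟩
  · rw [← hR, hP, Matrix.mul_assoc, Matrix.mul_assoc, Matrix.mul_assoc]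
  · conv_lhs => rw [hP, hQ]
    simp only [Matrix.mul_assoc]

/-- For one inclusion, a GL(n) translate of `x` reaches any prescribed point of the left orbit
without moving `jR x`, which reduces the claim to equal left momenta. For the other, GL(m) sweeps
out the whole right orbit while `jL x` stays fixed. -/
theorem orbitCorrespondence_adjointOrbit_jL (hx : x ∈ fullRankPairs n m) :
    orbitCorrespondence n m (adjointOrbit (jL x)) = adjointOrbit (jR x) := by
  ext Y
  constructor
  · rintro ⟨y, ⟨hy, hyx⟩, rfl⟩
    obtain ⟨A, B, hAB, hY⟩ := mem_adjointOrbit_iff.mp hyx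
    rw [← jR_left_mul (x := x) (mul_eq_one_comm.mp hAB)]
    exact jR_mem_adjointOrbit_of_jL_eq hy (hY.trans (jL_left_mul A B).symm)
  · intro hY
    obtain ⟨A, B, hAB, rfl⟩ := mem_adjointOrbit_iff.mp hY
    refine ⟨_, ⟨mul_right_mem_fullRankPairs hAB hx, ?_⟩, jR_mul_right A B⟩
    rw [jL_mul_right (mul_eq_one_comm.mp hAB)]
    exact self_mem_adjointOrbit _

end Correspondence

end DualPair

namespace DualPair

/-! ### Algebra of real Jordan blocks -/

section JordanBlock

/-- The matrix with `1` on the `k`-th superdiagonal and `0` elsewhere. -/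
def shift (c k : ℕ) : Matrix (Fin c) (Fin c) ℝ :=
  Matrix.of fun i j => if (i : ℕ) + k = j then 1 else 0

theorem shift_apply (c k : ℕ) (i j : Fin c) :
    shift c k i j = if (i : ℕ) + k = j then 1 else 0 := rfl

theorem shift_zero (c : ℕ) : shift c 0 = 1 := by
  ext i j
  simp [shift_apply, Matrix.one_apply, Fin.ext_iff]

theorem shift_mul_apply {c k : ℕ} {κ : Type*} (M : Matrix (Fin c) κ ℝ) (i : Fin c) (j : κ) :
    (shift c k * M) i j = if h : (i : ℕ) + k < c then M ⟨i + k, h⟩ j else 0 := by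
  rw [Matrix.mul_apply]
  split_ifs with h
  · rw [Finset.sum_eq_single ⟨i + k, h⟩]
    · simp [shift_apply]
    · intro b _ hb
      rw [shift_apply, if_neg, zero_mul]
      intro h'
      exact hb (Fin.ext h'.symm)
    · simp
  · refine Finset.sum_eq_zero fun b _ => ?_
    rw [shift_apply, if_neg, zero_mul]
    have := b.2
    omega

theorem shift_mul_shift (c k l : ℕ) : shift c k * shift c l = shift c (k + l) := by
  ext i j
  rw [shift_mul_apply]
  have := j.2
  simp only [shift_apply]
  split_ifs <;> first | rfl | omega

theorem shift_pow (c k e : ℕ) : shift c k ^ e = shift c (k * e) := by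
  induction e with
  | zero => simp [shift_zero]
  | succ e ih => rw [pow_succ, ih, shift_mul_shift]; ring_nf

theorem shift_eq_zero {c k : ℕ} (h : c ≤ k) : shift c k = 0 := by
  ext i j
  have := j.2
  rw [shift_apply, if_neg (by omega), Matrix.zero_apply]

theorem shift_ne_zero {c k : ℕ} (h : k < c) : shift c k ≠ 0 := by
  intro h0
  have := congrFun (congrFun h0 ⟨0, by omega⟩) ⟨k, h⟩
  simp [shift_apply] at this

theorem isNilpotent_shift {c k : ℕ} (hk : 1 ≤ k) : IsNilpotent (shift c k) :=
  ⟨c, by rw [shift_pow]; exact shift_eq_zero (Nat.le_mul_of_pos_left _ hk)⟩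

/-- The block diagonal matrix with diagonal blocks `[0, 1; -1, 0]`. -/
def rotation (c : ℕ) : Matrix (Fin c) (Fin c) ℝ :=
  Matrix.of fun i j =>
    if (i : ℕ) / 2 = (j : ℕ) / 2 then (if i = j then 0 else if i < j then 1 else -1) else 0

theorem rotation_mul_apply {c : ℕ} (hc : Even c) {κ : Type*} (M : Matrix (Fin c) κ ℝ)
    (i : Fin c) (j : κ) :
    (rotation c * M) i j =
      if h : (i : ℕ) % 2 = 0 then M ⟨i + 1, by have := i.2; obtain ⟨a, rfl⟩ := hc; omega⟩ j
      else - M ⟨i - 1, by have := i.2; omega⟩ j := by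
  rw [Matrix.mul_apply]
  split_ifs with h
  · rw [Finset.sum_eq_single ⟨i + 1, by have := i.2; obtain ⟨a, rfl⟩ := hc; omega⟩]
    · simp only [rotation, Matrix.of_apply, Fin.ext_iff, Fin.lt_def]
      rw [if_pos (by omega), if_neg (by omega), if_pos (by omega), one_mul]
    · intro b _ hb
      replace hb : (b : ℕ) ≠ i + 1 := fun h => hb (Fin.ext h)
      simp only [rotation, Matrix.of_apply, Fin.ext_iff, Fin.lt_def]
      split_ifs <;> first | omega | simp
    · simp
  · rw [Finset.sum_eq_single ⟨i - 1, by have := i.2; omega⟩]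
    · simp only [rotation, Matrix.of_apply, Fin.ext_iff, Fin.lt_def]
      rw [if_pos (by omega), if_neg (by omega), if_neg (by omega), neg_one_mul]
    · intro b _ hb
      replace hb : (b : ℕ) ≠ i - 1 := fun h => hb (Fin.ext h)
      simp only [rotation, Matrix.of_apply, Fin.ext_iff, Fin.lt_def]
      split_ifs <;> first | omega | simp
    · simp

theorem rotation_mul_rotation {c : ℕ} (hc : Even c) : rotation c * rotation c = -1 := by
  ext i j
  rw [rotation_mul_apply hc]
  simp only [rotation, Matrix.of_apply, Fin.ext_iff, Fin.lt_def, Matrix.neg_apply, Matrix.one_apply]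
  split_ifs <;> first | omega | simp

/-- The shift by two moves whole `2 × 2` blocks, and all diagonal blocks of the rotation are equal.
Evenness of `c` rules out a truncated last block. -/
theorem commute_rotation_shift {c : ℕ} (hc : Even c) : Commute (rotation c) (shift c 2) := by
  ext i j
  rw [rotation_mul_apply hc, shift_mul_apply]
  have hj := j.2
  have hi := i.2
  obtain ⟨a, rfl⟩ := hc
  simp only [rotation, shift, Matrix.of_apply, Fin.ext_iff, Fin.lt_def]
  split_ifs <;> first | omega | simp

theorem realJordanBlock_of_im_eq_zero {c : ℕ} {l : ℂ} (hl : l.im = 0) :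
    realJordanBlock c l = algebraMap ℝ _ l.re + shift c 1 := by
  ext i j
  simp only [realJordanBlock, hl, if_true, Matrix.of_apply, Matrix.add_apply,
    Matrix.algebraMap_matrix_apply, shift_apply, Fin.ext_iff]
  split_ifs <;> first | omega | simp

theorem realJordanBlock_of_im_ne_zero {c : ℕ} {l : ℂ} (hl : l.im ≠ 0) :
    realJordanBlock c l = algebraMap ℝ _ l.re + l.im • rotation c + shift c 2 := by
  ext i j
  simp only [realJordanBlock, hl, if_false, Matrix.of_apply, Matrix.add_apply, Matrix.smul_apply,
    Matrix.algebraMap_matrix_apply, shift_apply, rotation, Fin.ext_iff, Fin.lt_def]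
  split_ifs <;> first | omega | simp

/-- The block is an invertible matrix plus a nilpotent one commuting with it. -/
theorem isUnit_realJordanBlock {c : ℕ} {l : ℂ} (hl : l ≠ 0) (hc : l.im ≠ 0 → Even c) :
    IsUnit (realJordanBlock c l) := by
  by_cases h : l.im = 0
  · rw [realJordanBlock_of_im_eq_zero h]
    refine (isNilpotent_shift le_rfl).isUnit_add_left_of_commute ?_ (Algebra.commutes _ _).symm
    refine IsUnit.map _ (isUnit_iff_ne_zero.mpr fun h0 => hl (Complex.ext h0 h))
  · rw [realJordanBlock_of_im_ne_zero h]
    refine (isNilpotent_shift one_le_two).isUnit_add_left_of_commute ?_ ?_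
    · have h1 : (algebraMap ℝ (Matrix (Fin c) (Fin c) ℝ) l.re + l.im • rotation c) *
          ((Complex.normSq l)⁻¹ • (algebraMap ℝ _ l.re - l.im • rotation c)) = 1 := by
        rw [mul_smul_comm, ← Commute.mul_self_sub_mul_self_eq (Algebra.commute_algebraMap_left l.re _),
          smul_mul_smul_comm, rotation_mul_rotation (hc h), ← map_mul]
        have : Complex.normSq l ≠ 0 := by simpa using hl
        rw [Complex.normSq_apply] at this ⊢
        ext i j
        simp only [Matrix.smul_apply, Matrix.sub_apply, Matrix.neg_apply,
          Matrix.algebraMap_matrix_apply, Matrix.one_apply, smul_eq_mul]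
        split_ifs
        · simp
          field_simp
        · simp
      exact IsUnit.of_mul_eq_one _ h1
    · exact Commute.add_right (Algebra.commutes _ _).symm
        ((commute_rotation_shift (hc h)).symm.smul_right _)

end JordanBlock

/-! ### A full-rank pair realizing both normal forms -/

section Factorization

/-- The inclusion of the first `d - 1` coordinates. -/
def castMatrix (d : ℕ) : Matrix (Fin d) (Fin (d - 1)) ℝ :=
  Matrix.of fun i j => if (i : ℕ) = j then 1 else 0

/-- The projection onto the last `d - 1` coordinates. -/
def succMatrix (d : ℕ) : Matrix (Fin (d - 1)) (Fin d) ℝ :=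
  Matrix.of fun i j => if (i : ℕ) + 1 = j then 1 else 0

/-- Dropping the first coordinate and re-embedding into the first `d - 1` coordinates is the
nilpotent shift. Together with `succMatrix_mul_castMatrix`, this is the source of the passage from
`d` to `d - 1`. -/
theorem castMatrix_mul_succMatrix (d : ℕ) :
    castMatrix d * succMatrix d = realJordanBlock d 0 := by
  ext i k
  rw [realJordanBlock_of_im_eq_zero rfl, Matrix.mul_apply]
  simp only [castMatrix, succMatrix, Matrix.of_apply, Matrix.add_apply, shift_apply,
    Complex.zero_re, map_zero, Matrix.zero_apply, zero_add]
  have hk := k.2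
  split_ifs with h
  · rw [Finset.sum_eq_single ⟨i, by omega⟩]
    · simp [h]
    · intro b _ hb
      rw [if_neg (fun h' => hb (Fin.ext h'.symm)), zero_mul]
    · simp
  · refine Finset.sum_eq_zero fun b _ => ?_
    split_ifs <;> first | omega | simp

theorem succMatrix_mul_castMatrix (d : ℕ) :
    succMatrix d * castMatrix d = realJordanBlock (d - 1) 0 := by
  ext i k
  rw [realJordanBlock_of_im_eq_zero rfl, Matrix.mul_apply]
  simp only [castMatrix, succMatrix, Matrix.of_apply, Matrix.add_apply, shift_apply,
    Complex.zero_re, map_zero, Matrix.zero_apply, zero_add]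
  have hi := i.2
  rw [Finset.sum_eq_single ⟨i + 1, by omega⟩]
  · simp
  · intro b _ hb
    rw [if_neg (fun h' => hb (Fin.ext h'.symm)), zero_mul]
  · simp

theorem castMatrix_transpose_mul (d : ℕ) : (castMatrix d)ᵀ * castMatrix d = 1 := by
  ext i k
  rw [Matrix.mul_apply]
  simp only [castMatrix, Matrix.of_apply, Matrix.transpose_apply, Matrix.one_apply]
  have hi := i.2
  rw [Finset.sum_eq_single ⟨i, by omega⟩]
  · simp [Fin.ext_iff]
  · intro b _ hb
    rw [if_neg (fun h' => hb (Fin.ext h')), zero_mul]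
  · simp

theorem succMatrix_mul_transpose (d : ℕ) : succMatrix d * (succMatrix d)ᵀ = 1 := by
  ext i k
  rw [Matrix.mul_apply]
  simp only [succMatrix, Matrix.of_apply, Matrix.transpose_apply, Matrix.one_apply]
  have hi := i.2
  rw [Finset.sum_eq_single ⟨i + 1, by omega⟩]
  · simp [Fin.ext_iff, eq_comm]
  · intro b _ hb
    rw [if_neg (fun h' => hb (Fin.ext h'.symm)), zero_mul]
  · simp

theorem blockDiagonal'_fun_one {p : ℕ} (c : Fin p → ℕ) :
    (Matrix.blockDiagonal' fun i => (1 : Matrix (Fin (c i)) (Fin (c i)) ℝ)) = 1 :=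
  Matrix.blockDiagonal'_one

variable {n m : ℕ}

namespace JordanData

theorem even_c_of_im_ne_zero (D : JordanData n m) (i : Fin D.p) (h : (D.lam i).im ≠ 0) :
    Even (D.c i) :=
  D.even_c i (lt_of_le_of_ne (D.lam_im_nonneg i) (Ne.symm h))

/-- A pair of full-rank matrices with momenta `D.zeta` and `D.xi`. -/
noncomputable def pair (D : JordanData n m) : Matrix (Fin n) (Fin m) ℝ × Matrix (Fin n) (Fin m) ℝ :=
  (Matrix.reindex D.zetaIndex D.xiIndex (Matrix.fromBlocks 1 0 0
      (Matrix.fromRows (Matrix.blockDiagonal' fun j => castMatrix (D.d j)) 0)),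
    (Matrix.reindex D.xiIndex D.zetaIndex (Matrix.fromBlocks
      (Matrix.blockDiagonal' fun i => realJordanBlock (D.c i) (D.lam i)) 0 0
      (Matrix.fromCols (Matrix.blockDiagonal' fun j => succMatrix (D.d j)) 0)))ᵀ)

theorem jL_pair (D : JordanData n m) : jL D.pair = D.zeta := by
  simp only [jL, pair, zeta, Matrix.transpose_transpose, Matrix.reindex_apply,
    Matrix.submatrix_mul_equiv, Matrix.fromBlocks_multiply]
  congr 2
  · simp
  · simp
  · simp
  · rw [Matrix.zero_mul, zero_add, Matrix.fromRows_mul_fromCols, ← Matrix.blockDiagonal'_mul]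
    simp [castMatrix_mul_succMatrix]

theorem jR_pair (D : JordanData n m) : jR D.pair = D.xi := by
  simp only [jR, pair, xi, Matrix.transpose_transpose, Matrix.reindex_apply,
    Matrix.submatrix_mul_equiv, Matrix.fromBlocks_multiply]
  congr 2 <;> simp [Matrix.fromCols_mul_fromRows, ← Matrix.blockDiagonal'_mul,
    succMatrix_mul_castMatrix]

/-- One-sided inverses are assembled blockwise: transposes for the coordinate maps, and inverses of
the Jordan blocks with non-zero eigenvalue. -/
theorem pair_mem_fullRankPairs (D : JordanData n m) : D.pair ∈ fullRankPairs n m := by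
  rw [mem_fullRankPairs_iff]
  constructor
  · refine ⟨Matrix.reindex D.xiIndex D.zetaIndex (Matrix.fromBlocks 1 0 0
      (Matrix.fromCols (Matrix.blockDiagonal' fun j => (castMatrix (D.d j))ᵀ) 0)), ?_⟩
    simp only [pair, Matrix.reindex_apply, Matrix.submatrix_mul_equiv, Matrix.fromBlocks_multiply]
    simp [Matrix.fromCols_mul_fromRows, ← Matrix.blockDiagonal'_mul, castMatrix_transpose_mul,
      blockDiagonal'_fun_one]
  · have h : ∀ i, realJordanBlock (D.c i) (D.lam i) * (realJordanBlock (D.c i) (D.lam i))⁻¹ = 1 :=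
      fun i => Matrix.mul_nonsing_inv _ ((Matrix.isUnit_iff_isUnit_det _).mp
        (isUnit_realJordanBlock (D.lam_ne_zero i) (D.even_c_of_im_ne_zero i)))
    refine ⟨Matrix.reindex D.zetaIndex D.xiIndex (Matrix.fromBlocks
      (Matrix.blockDiagonal' fun i => (realJordanBlock (D.c i) (D.lam i))⁻¹) 0 0
      (Matrix.fromRows (Matrix.blockDiagonal' fun j => (succMatrix (D.d j))ᵀ) 0)), ?_⟩
    simp only [pair, Matrix.transpose_transpose, Matrix.reindex_apply, Matrix.submatrix_mul_equiv,
      Matrix.fromBlocks_multiply]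
    simp [Matrix.fromCols_mul_fromRows, ← Matrix.blockDiagonal'_mul, succMatrix_mul_transpose, h,
      blockDiagonal'_fun_one]

end JordanData

end Factorization

end DualPair

namespace DualPair

open Polynomial Module

/-! ### Conjugacy classes as isomorphism classes of `ℝ[X]`-modules -/

section PolyModule

/-- The `ℝ[X]`-module on which `X` acts through the matrix `A`. -/
abbrev PolyModule {κ : Type*} [Fintype κ] [DecidableEq κ] (A : Matrix κ κ ℝ) :=
  AEval' (Matrix.toLin' A)

variable {κ : Type*} [Fintype κ] [DecidableEq κ]

theorem smul_of_eq (A : Matrix κ κ ℝ) (f : ℝ[X]) (v : κ → ℝ) :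
    f • AEval'.of (Matrix.toLin' A) v = AEval'.of (Matrix.toLin' A) (aeval A f *ᵥ v) := by
  have h : aeval (Matrix.toLin' A) f = Matrix.toLin' (aeval A f) :=
    aeval_algHom_apply (Matrix.toLinAlgEquiv' : Matrix κ κ ℝ ≃ₐ[ℝ] _).toAlgHom A f
  rw [← Matrix.toLin'_apply, ← h]
  exact (AEval.of_aeval_smul _ _ _).symm

/-- A linear equivalence that turns the matrix `A` into multiplication by `X`. -/
noncomputable def polyModuleEquiv {N : Type*} [AddCommGroup N] [Module ℝ N] [Module ℝ[X] N]
    [IsScalarTower ℝ ℝ[X] N] {A : Matrix κ κ ℝ} (e : (κ → ℝ) ≃ₗ[ℝ] N)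
    (h : ∀ v, e (A *ᵥ v) = (X : ℝ[X]) • e v) : PolyModule A ≃ₗ[ℝ[X]] N :=
  LinearEquiv.ofAEval (Matrix.toLin' A) e h

/-- An `ℝ[X]`-linear isomorphism is an invertible real linear map intertwining the actions of `X`,
which here are `A` and `B`. -/
theorem mem_adjointOrbit_iff_nonempty_equiv {k : ℕ} {A B : Matrix (Fin k) (Fin k) ℝ} :
    B ∈ adjointOrbit A ↔ Nonempty (PolyModule A ≃ₗ[ℝ[X]] PolyModule B) := by
  constructor
  · intro h
    obtain ⟨S, T, hST, rfl⟩ := mem_adjointOrbit_iff.mp h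
    have hTS : T * S = 1 := mul_eq_one_comm.mp hST
    refine ⟨polyModuleEquiv ((Matrix.toLin'OfInv hTS hST).trans (AEval'.of _)) fun v => ?_⟩
    simp only [LinearEquiv.trans_apply, AEval'.X_smul_of]
    congr 1
    change S *ᵥ (A *ᵥ v) = (S * A * T) *ᵥ (S *ᵥ v)
    rw [Matrix.mulVec_mulVec, Matrix.mulVec_mulVec, Matrix.mul_assoc _ T, hTS, Matrix.mul_one]
  · rintro ⟨e⟩
    let g : (Fin k → ℝ) ≃ₗ[ℝ] (Fin k → ℝ) :=
      (AEval'.of (Matrix.toLin' A)).trans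
        ((e.restrictScalars ℝ).trans (AEval'.of (Matrix.toLin' B)).symm)
    have hg : ∀ v, g (A *ᵥ v) = B *ᵥ g v := by
      intro v
      change (AEval'.of (Matrix.toLin' B)).symm (e (AEval'.of (Matrix.toLin' A)
        (Matrix.toLin' A v))) = Matrix.toLin' B ((AEval'.of (Matrix.toLin' B)).symm
          (e (AEval'.of (Matrix.toLin' A) v)))
      rw [← AEval'.X_smul_of, map_smul, AEval'.of_symm_X_smul]
    have hinv : LinearMap.toMatrix' (g : (Fin k → ℝ) →ₗ[ℝ] (Fin k → ℝ)) *
        LinearMap.toMatrix' (g.symm : (Fin k → ℝ) →ₗ[ℝ] (Fin k → ℝ)) = 1 := by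
      rw [← LinearMap.toMatrix'_comp, LinearEquiv.comp_symm, LinearMap.toMatrix'_id]
    refine mem_adjointOrbit_iff.mpr ⟨_, _, hinv, ?_⟩
    have hcomm : LinearMap.toMatrix' (g : (Fin k → ℝ) →ₗ[ℝ] (Fin k → ℝ)) * A =
        B * LinearMap.toMatrix' (g : (Fin k → ℝ) →ₗ[ℝ] (Fin k → ℝ)) := by
      apply Matrix.toLin'.injective
      refine LinearMap.ext fun v => ?_
      simp only [Matrix.toLin'_mul, Matrix.toLin'_toMatrix']
      exact hg v
    rw [hcomm, Matrix.mul_assoc, hinv, Matrix.mul_one]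

noncomputable def polyModuleReindex {κ' : Type*} [Fintype κ'] [DecidableEq κ'] (σ : κ ≃ κ')
    (A : Matrix κ κ ℝ) : PolyModule (Matrix.reindex σ σ A) ≃ₗ[ℝ[X]] PolyModule A :=
  polyModuleEquiv ((LinearEquiv.funCongrLeft ℝ ℝ σ).trans (AEval'.of _)) fun v => by
    simp only [LinearEquiv.trans_apply, AEval'.X_smul_of]
    congr 1
    rw [Matrix.toLin'_apply, Matrix.reindex_apply, Matrix.submatrix_mulVec_equiv]
    ext i
    simp [LinearEquiv.funCongrLeft_apply, LinearMap.funLeft_apply]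
    rfl

noncomputable def polyModuleFromBlocks {κ' : Type*} [Fintype κ'] [DecidableEq κ']
    (A : Matrix κ κ ℝ) (B : Matrix κ' κ' ℝ) :
    PolyModule (Matrix.fromBlocks A 0 0 B) ≃ₗ[ℝ[X]] PolyModule A × PolyModule B :=
  polyModuleEquiv ((LinearEquiv.sumArrowLequivProdArrow κ κ' ℝ ℝ).trans
    ((AEval'.of _).prodCongr (AEval'.of _))) fun v => by
    simp only [LinearEquiv.trans_apply, LinearEquiv.prodCongr_apply, Prod.smul_mk,
      AEval'.X_smul_of]
    congr 2 <;> · ext i; simp [Matrix.fromBlocks_mulVec]; rfl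

noncomputable def polyModuleBlockDiagonal {ι : Type*} [Fintype ι] [DecidableEq ι] {κ : ι → Type*}
    [∀ i, Fintype (κ i)] [∀ i, DecidableEq (κ i)] (A : ∀ i, Matrix (κ i) (κ i) ℝ) :
    PolyModule (Matrix.blockDiagonal' A) ≃ₗ[ℝ[X]] ∀ i, PolyModule (A i) :=
  polyModuleEquiv ((LinearEquiv.piCurry ℝ fun _ _ => ℝ).trans
    (LinearEquiv.piCongrRight fun _ => AEval'.of _)) fun v => by
    ext1 i
    simp only [LinearEquiv.trans_apply, LinearEquiv.piCongrRight_apply, Pi.smul_apply,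
      AEval'.X_smul_of]
    congr 1
    ext a
    change (Matrix.blockDiagonal' A *ᵥ v) ⟨i, a⟩ = (A i *ᵥ fun b => v ⟨i, b⟩) a
    simp only [Matrix.mulVec, dotProduct, Fintype.sum_sigma]
    rw [Finset.sum_eq_single i]
    · simp [Matrix.blockDiagonal'_apply_eq]
    · intro j _ hj
      exact Finset.sum_eq_zero fun b _ => by
        rw [Matrix.blockDiagonal'_apply_ne _ _ _ (Ne.symm hj), zero_mul]
    · simp

theorem finite_quotient_span {f : ℝ[X]} (hf : f ≠ 0) :
    Module.Finite ℝ (ℝ[X] ⧸ Ideal.span {f}) :=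
  (AdjoinRoot.powerBasis hf).finite

/-- A matrix annihilated by `p ^ e` but not by `p ^ (e - 1)`, of size the degree of `p ^ e`, has
a cyclic module. -/
theorem nonempty_polyModule_equiv_quotient {A : Matrix κ κ ℝ} {p : ℝ[X]} (hp : Irreducible p)
    {e : ℕ} (h0 : aeval A (p ^ e) = 0) (h1 : aeval A (p ^ (e - 1)) ≠ 0)
    (hd : (p ^ e).natDegree = Fintype.card κ) :
    Nonempty (PolyModule A ≃ₗ[ℝ[X]] ℝ[X] ⧸ Ideal.span {p ^ e}) := by
  -- A vector not killed by `p ^ (e - 1)` will be a cyclic generator.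
  obtain ⟨v, hv⟩ : ∃ v, aeval A (p ^ (e - 1)) *ᵥ v ≠ 0 := by
    by_contra! h
    exact h1 (Matrix.toLin'.injective (LinearMap.ext fun v => by
      rw [Matrix.toLin'_apply, h, map_zero, LinearMap.zero_apply]))
  let φ : ℝ[X] →ₗ[ℝ[X]] PolyModule A :=
    LinearMap.toSpanSingleton ℝ[X] (PolyModule A) (AEval'.of (Matrix.toLin' A) v)
  have hφ : ∀ f, φ f = AEval'.of (Matrix.toLin' A) (aeval A f *ᵥ v) := fun f => by
    rw [← smul_of_eq]
    rfl
  have hle : Ideal.span {p ^ e} ≤ LinearMap.ker φ := by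
    rw [Ideal.span_singleton_le_iff_mem, LinearMap.mem_ker, hφ, h0, Matrix.zero_mulVec, map_zero]
  -- The annihilator of `v` is generated by a divisor of `p ^ e`, hence by some `p ^ j` up to a
  -- unit; `j < e` would make `p ^ (e - 1)` kill `v`.
  have hge : LinearMap.ker φ ≤ Ideal.span {p ^ e} := by
    intro f hf
    obtain ⟨g, hg⟩ := (IsPrincipalIdealRing.principal (LinearMap.ker φ)).principal
    have hge : g ∣ p ^ e := by
      rw [← Ideal.mem_span_singleton]
      have : p ^ e ∈ LinearMap.ker φ := hle (Ideal.mem_span_singleton_self _)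
      rw [hg] at this
      exact this
    obtain ⟨j, hj, hgj⟩ := (dvd_prime_pow hp.prime e).mp hge
    have hj' : j = e := by
      by_contra hne
      have h2 : p ^ (e - 1) ∈ LinearMap.ker φ := by
        rw [hg]
        exact Ideal.mem_span_singleton.mpr (hgj.dvd.trans (pow_dvd_pow p (by omega)))
      rw [LinearMap.mem_ker, hφ] at h2
      exact hv ((AEval'.of (Matrix.toLin' A)).map_eq_zero_iff.mp h2)
    subst hj'
    rw [hg] at hf
    exact Ideal.mem_span_singleton.mpr (hgj.symm.dvd.trans (Ideal.mem_span_singleton.mp hf))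
  let ψ : (ℝ[X] ⧸ Ideal.span {p ^ e}) →ₗ[ℝ[X]] PolyModule A :=
    Submodule.liftQ (Ideal.span {p ^ e}) φ hle
  have hinj : Function.Injective ψ :=
    LinearMap.ker_eq_bot.mp (Submodule.ker_liftQ_eq_bot _ _ _ hge)
  have hfin : Module.Finite ℝ (ℝ[X] ⧸ Ideal.span {p ^ e}) :=
    finite_quotient_span (pow_ne_zero _ hp.ne_zero)
  have hrank : finrank ℝ (ℝ[X] ⧸ Ideal.span {p ^ e}) = finrank ℝ (PolyModule A) := by
    rw [finrank_quotient_span_eq_natDegree, hd, ← (AEval'.of (Matrix.toLin' A)).finrank_eq,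
      finrank_fintype_fun_eq_card]
  -- The degree hypothesis makes both real dimensions equal, so injectivity suffices.
  have hsurj : Function.Surjective ψ :=
    (LinearMap.injective_iff_surjective_of_finrank_eq_finrank
      (f := ψ.restrictScalars ℝ) hrank).mp hinj
  exact ⟨(LinearEquiv.ofBijective ψ ⟨hinj, hsurj⟩).symm⟩

end PolyModule

/-! ### Elementary divisors of real Jordan blocks -/

section JordanBlock

/-- The exponent of the irreducible polynomial in the elementary divisor of `J_c(l)`. -/
noncomputable def jordanExponent (b : ℂ × ℕ) : ℕ :=
  if b.1.im = 0 then b.2 else b.2 / 2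

/-- The elementary divisor of the real Jordan block `J_c(l)`. -/
noncomputable def elementaryDivisor (b : ℂ × ℕ) : ℝ[X] :=
  minpoly ℝ b.1 ^ jordanExponent b

theorem minpoly_of_im_eq_zero {l : ℂ} (h : l.im = 0) : minpoly ℝ l = X - C l.re := by
  have : l = algebraMap ℝ ℂ l.re := Complex.ext rfl (by simpa using h)
  rw [this]
  exact minpoly.eq_X_sub_C ℂ l.re

theorem minpoly_of_im_ne_zero {l : ℂ} (h : l.im ≠ 0) :
    minpoly ℝ l = (X - C l.re) ^ 2 + C (l.im ^ 2) := by
  have hq : (X - C l.re) ^ 2 + C (l.im ^ 2) = X ^ 2 - C (2 * l.re) * X + C (‖l‖ ^ 2) := by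
    rw [Complex.sq_norm, Complex.normSq_apply]
    simp only [map_mul, map_add, map_pow, map_ofNat]
    ring
  have hroot : aeval l ((X - C l.re) ^ 2 + C (l.im ^ 2)) = 0 := by
    simp only [map_add, map_pow, map_sub, aeval_X, aeval_C, Complex.coe_algebraMap]
    apply Complex.ext <;> simp [pow_two]
  have hmonic : ((X - C l.re) ^ 2 + C (l.im ^ 2)).Monic := by
    monicity!
  refine eq_of_monic_of_associated (minpoly.monic (Algebra.IsIntegral.isIntegral l)) hmonic
    (associated_of_dvd_dvd (minpoly.dvd ℝ l hroot) ?_)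
  rw [hq]
  exact quadratic_dvd_of_aeval_eq_zero_im_ne_zero _ (minpoly.aeval ℝ l) h

theorem irreducible_minpoly (l : ℂ) : Irreducible (minpoly ℝ l) :=
  minpoly.irreducible (Algebra.IsIntegral.isIntegral l)

theorem natDegree_minpoly_of_im_ne_zero {l : ℂ} (h : l.im ≠ 0) : (minpoly ℝ l).natDegree = 2 := by
  rw [minpoly_of_im_ne_zero h]
  compute_degree!

theorem natDegree_elementaryDivisor {b : ℂ × ℕ} (hb : b.1.im ≠ 0 → Even b.2) :
    (elementaryDivisor b).natDegree = b.2 := by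
  rw [elementaryDivisor, natDegree_pow, jordanExponent]
  split_ifs with h
  · rw [minpoly_of_im_eq_zero h, natDegree_X_sub_C, mul_one]
  · rw [natDegree_minpoly_of_im_ne_zero h, Nat.div_mul_cancel (hb h).two_dvd]

/-- A real minimal polynomial determines its root up to conjugation, and the closed upper half-plane
contains one point of each conjugate pair. -/
theorem eq_of_minpoly_eq {l l' : ℂ} (h : minpoly ℝ l = minpoly ℝ l') (hl : 0 ≤ l.im)
    (hl' : 0 ≤ l'.im) : l = l' := by
  have hroot : aeval l' (minpoly ℝ l) = 0 := by rw [h, minpoly.aeval]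
  by_cases h0 : l.im = 0
  · rw [minpoly_of_im_eq_zero h0] at hroot
    simp only [map_sub, aeval_X, aeval_C, Complex.coe_algebraMap, sub_eq_zero] at hroot
    rw [hroot]
    exact Complex.ext rfl (by simpa using h0)
  · rw [minpoly_of_im_ne_zero h0] at hroot
    have hre := congrArg Complex.re hroot
    have him := congrArg Complex.im hroot
    simp [pow_two] at hre him
    have hpos : 0 < l.im := lt_of_le_of_ne hl (Ne.symm h0)
    rcases eq_or_ne l'.im 0 with h1 | h1
    · rw [h1] at hre
      nlinarith [mul_self_nonneg (l'.re - l.re), mul_pos hpos hpos]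
    · have h2 : l'.re = l.re := by
        have : (l'.re - l.re) * l'.im = 0 := by linarith
        rcases mul_eq_zero.mp this with h3 | h3
        · linarith
        · exact absurd h3 h1
      rw [h2] at hre
      refine Complex.ext h2.symm ?_
      nlinarith

/-- A complex root exists, and its conjugate is also a root, so one lies in the closed upper
half-plane. -/
theorem exists_associated_minpoly {p : ℝ[X]} (hp : Irreducible p) :
    ∃ l : ℂ, 0 ≤ l.im ∧ Associated p (minpoly ℝ l) := by
  obtain ⟨z, hz⟩ : ∃ z : ℂ, aeval z p = 0 :=
    IsAlgClosed.exists_aeval_eq_zero _ p (degree_pos_of_irreducible hp).ne'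
  have key : ∀ z : ℂ, aeval z p = 0 → Associated p (minpoly ℝ z) := fun z hz =>
    ((irreducible_minpoly z).associated_of_dvd hp (minpoly.dvd ℝ z hz)).symm
  rcases le_total 0 z.im with h | h
  · exact ⟨z, h, key z hz⟩
  · refine ⟨starRingEnd ℂ z, by simpa using h, key _ ?_⟩
    rw [aeval_conj, hz, map_zero]

/-- With `R² = -1` and `N` the shift by two, the value is `(bR + N)² + b² = N(2bR + N)`. The second
factor is a unit, so this element has the same nilpotency exponent as `N`. -/
theorem aeval_realJordanBlock_of_im_ne_zero {c : ℕ} {l : ℂ} (h : l.im ≠ 0) (hc : Even c) :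
    aeval (realJordanBlock c l) (minpoly ℝ l) =
      shift c 2 * ((2 * l.im) • rotation c + shift c 2) := by
  have hcomm := (commute_rotation_shift hc).eq
  rw [minpoly_of_im_ne_zero h, realJordanBlock_of_im_ne_zero h]
  simp only [map_add, map_pow, map_sub, aeval_X, aeval_C]
  rw [add_assoc, add_sub_cancel_left, pow_two, add_mul, mul_add, mul_add, mul_add,
    smul_mul_smul_comm, rotation_mul_rotation hc, smul_mul_assoc, hcomm, mul_smul_comm,
    mul_smul_comm, ← pow_two l.im, mul_smul, two_smul, smul_neg, ← map_pow, Algebra.algebraMap_eq_smul_one]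
  abel

theorem nonempty_polyModule_realJordanBlock_equiv {c : ℕ} {l : ℂ} (hc : 1 ≤ c)
    (hl : l.im ≠ 0 → Even c) :
    Nonempty (PolyModule (realJordanBlock c l) ≃ₗ[ℝ[X]]
      ℝ[X] ⧸ Ideal.span {elementaryDivisor (l, c)}) := by
  have hd := natDegree_elementaryDivisor (b := (l, c)) hl
  refine nonempty_polyModule_equiv_quotient (irreducible_minpoly l) ?_ ?_ (hd.trans (Fintype.card_fin c).symm)
  · by_cases h : l.im = 0
    · have h1 : aeval (realJordanBlock c l) (minpoly ℝ l) = shift c 1 := by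
        rw [minpoly_of_im_eq_zero h, realJordanBlock_of_im_eq_zero h]
        simp
      rw [map_pow, h1, shift_pow, jordanExponent, if_pos h]
      exact shift_eq_zero (by simp)
    · have hcomm : Commute (shift c 2) ((2 * l.im) • rotation c + shift c 2) :=
        ((commute_rotation_shift (hl h)).symm.smul_right _).add_right (Commute.refl _)
      rw [map_pow, aeval_realJordanBlock_of_im_ne_zero h (hl h), hcomm.mul_pow, shift_pow,
        jordanExponent, if_neg h, shift_eq_zero, zero_mul]
      rw [Nat.mul_div_cancel' (hl h).two_dvd]
  · by_cases h : l.im = 0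
    · have h1 : aeval (realJordanBlock c l) (minpoly ℝ l) = shift c 1 := by
        rw [minpoly_of_im_eq_zero h, realJordanBlock_of_im_eq_zero h]
        simp
      rw [map_pow, h1, shift_pow, jordanExponent, if_pos h]
      exact shift_ne_zero (by simp; omega)
    · have hcomm : Commute (shift c 2) ((2 * l.im) • rotation c) :=
        (commute_rotation_shift (hl h)).symm.smul_right _
      have hcomm' : Commute (shift c 2) ((2 * l.im) • rotation c + shift c 2) :=
        hcomm.add_right (Commute.refl _)
      have hunit : IsUnit ((2 * l.im) • rotation c) := by
        refine IsUnit.of_mul_eq_one ((-(2 * l.im)⁻¹) • rotation c) ?_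
        rw [smul_mul_smul_comm, rotation_mul_rotation (hl h), mul_neg, neg_smul_neg,
          mul_inv_cancel₀ (mul_ne_zero two_ne_zero h), one_smul]
      rw [map_pow, aeval_realJordanBlock_of_im_ne_zero h (hl h), hcomm'.mul_pow, shift_pow,
        jordanExponent, if_neg h]
      -- The invertible factor can be cancelled, leaving a shift by `2 * (c / 2 - 1)`, which is less
      -- than `c`.
      have hu := ((isNilpotent_shift one_le_two).isUnit_add_left_of_commute hunit hcomm).pow
        (c / 2 - 1)
      rw [Ne, hu.mul_left_eq_zero]
      obtain ⟨a, rfl⟩ := hl h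
      exact shift_ne_zero (by omega)

end JordanBlock

end DualPair

namespace DualPair

open Polynomial Module

/-! ### Dimensions of torsion submodules -/

section TorsionBy

variable {M N : Type*} [AddCommGroup M] [Module ℝ[X] M] [Module ℝ M] [IsScalarTower ℝ ℝ[X] M]
  [AddCommGroup N] [Module ℝ[X] N] [Module ℝ N] [IsScalarTower ℝ ℝ[X] N]

theorem finrank_torsionBy_eq_of_equiv (e : M ≃ₗ[ℝ[X]] N) (a : ℝ[X]) :
    finrank ℝ (Submodule.torsionBy ℝ[X] M a) = finrank ℝ (Submodule.torsionBy ℝ[X] N a) := by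
  have h : (Submodule.torsionBy ℝ[X] M a).map (e : M →ₗ[ℝ[X]] N) =
      Submodule.torsionBy ℝ[X] N a := by
    ext y
    simp only [Submodule.mem_map, Submodule.mem_torsionBy_iff]
    constructor
    · rintro ⟨x, hx, rfl⟩
      rw [← map_smul, hx, map_zero]
    · intro hy
      refine ⟨e.symm y, ?_, e.apply_symm_apply y⟩
      rw [← map_smul, hy, map_zero]
  exact ((e.ofSubmodules _ _ h).restrictScalars ℝ).finrank_eq

theorem finrank_torsionBy_pi {ι : Type*} [Fintype ι] (M : ι → Type*) [∀ i, AddCommGroup (M i)]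
    [∀ i, Module ℝ[X] (M i)] [∀ i, Module ℝ (M i)] [∀ i, IsScalarTower ℝ ℝ[X] (M i)]
    [∀ i, Module.Finite ℝ (M i)] (a : ℝ[X]) :
    finrank ℝ (Submodule.torsionBy ℝ[X] (∀ i, M i) a) =
      ∑ i, finrank ℝ (Submodule.torsionBy ℝ[X] (M i) a) := by
  let e : Submodule.torsionBy ℝ[X] (∀ i, M i) a ≃ₗ[ℝ]
      ∀ i, Submodule.torsionBy ℝ[X] (M i) a :=
    { toFun := fun x i => ⟨x.1 i, congrFun x.2 i⟩
      invFun := fun x => ⟨fun i => x i, funext fun i => (x i).2⟩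
      map_add' := fun _ _ => rfl
      map_smul' := fun _ _ => rfl
      left_inv := fun _ => rfl
      right_inv := fun _ => rfl }
  have hfin : ∀ i, Module.Finite ℝ (Submodule.torsionBy ℝ[X] (M i) a) := fun i =>
    Module.Finite.of_injective
      ((Submodule.torsionBy ℝ[X] (M i) a).subtype.restrictScalars ℝ) Subtype.val_injective
  rw [e.finrank_eq, finrank_pi_fintype]

theorem finrank_torsionBy_pow_quotient {p : ℝ[X]} (hp : Irreducible p) (e k : ℕ) :
    finrank ℝ (Submodule.torsionBy ℝ[X] (ℝ[X] ⧸ Ideal.span {p ^ e}) (p ^ k)) =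
      p.natDegree * min k e := by
  -- The `p ^ k`-torsion is the cyclic submodule generated by the class of `p ^ (e - k)`. Truncated
  -- subtraction covers `k ≥ e`, where the generator is `1` and everything is torsion.
  let φ : ℝ[X] →ₗ[ℝ[X]] (ℝ[X] ⧸ Ideal.span {p ^ e}) :=
    LinearMap.toSpanSingleton _ _ (Ideal.Quotient.mk (Ideal.span {p ^ e}) (p ^ (e - k)))
  have hφ : ∀ f, φ f = Ideal.Quotient.mk (Ideal.span {p ^ e}) (f * p ^ (e - k)) := fun f => by
    rw [map_mul]
    rfl
  have hker : LinearMap.ker φ = Ideal.span {p ^ min k e} := by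
    ext f
    rw [LinearMap.mem_ker, hφ, Ideal.Quotient.eq_zero_iff_mem, Ideal.mem_span_singleton,
      Ideal.mem_span_singleton]
    conv_lhs => rw [show e = min k e + (e - k) by omega, pow_add]
    rw [show min k e + (e - k) - k = e - k by omega]
    exact mul_dvd_mul_iff_right (pow_ne_zero _ hp.ne_zero)
  have hrange : LinearMap.range φ = Submodule.torsionBy ℝ[X] (ℝ[X] ⧸ Ideal.span {p ^ e}) (p ^ k) := by
    ext y
    obtain ⟨y, rfl⟩ := Ideal.Quotient.mk_surjective y
    have hy : p ^ k • Ideal.Quotient.mk (Ideal.span {p ^ e}) y =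
        Ideal.Quotient.mk (Ideal.span {p ^ e}) (p ^ k * y) := by
      rw [map_mul]
      rfl
    rw [LinearMap.mem_range, Submodule.mem_torsionBy_iff, hy, Ideal.Quotient.eq_zero_iff_mem,
      Ideal.mem_span_singleton]
    constructor
    · rintro ⟨f, hf⟩
      rw [hφ, Ideal.Quotient.eq, Ideal.mem_span_singleton] at hf
      have h1 : p ^ e ∣ p ^ k * (f * p ^ (e - k)) := by
        rw [mul_left_comm, ← pow_add]
        exact (pow_dvd_pow p (by omega)).mul_left f
      have h2 := h1.sub (hf.mul_left (p ^ k))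
      rwa [← mul_sub, sub_sub_cancel] at h2
    · intro hdvd
      have h1 : p ^ (e - k) ∣ y := by
        rcases le_total k e with h | h
        · rw [show e = k + (e - k) by omega, pow_add] at hdvd
          exact (mul_dvd_mul_iff_left (pow_ne_zero _ hp.ne_zero)).mp hdvd
        · rw [Nat.sub_eq_zero_of_le h, pow_zero]
          exact one_dvd y
      obtain ⟨g, rfl⟩ := h1
      exact ⟨g, by rw [hφ, mul_comm]⟩
  rw [← hrange, ← (φ.quotKerEquivRange.restrictScalars ℝ).finrank_eq, hker,
    finrank_quotient_span_eq_natDegree, natDegree_pow, mul_comm]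

theorem finrank_torsionBy_quotient_of_isCoprime {f g : ℝ[X]} (h : IsCoprime f g) :
    finrank ℝ (Submodule.torsionBy ℝ[X] (ℝ[X] ⧸ Ideal.span {f}) g) = 0 := by
  have hbot : Submodule.torsionBy ℝ[X] (ℝ[X] ⧸ Ideal.span {f}) g = ⊥ := by
    rw [eq_bot_iff]
    intro y hy
    obtain ⟨y, rfl⟩ := Ideal.Quotient.mk_surjective y
    rw [Submodule.mem_torsionBy_iff] at hy
    have hy' : Ideal.Quotient.mk (Ideal.span {f}) (g * y) = 0 := by
      rw [map_mul]
      exact hy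
    rw [Ideal.Quotient.eq_zero_iff_mem, Ideal.mem_span_singleton] at hy'
    rw [Submodule.mem_bot, Ideal.Quotient.eq_zero_iff_mem, Ideal.mem_span_singleton]
    exact h.dvd_of_dvd_mul_left hy'
  rw [hbot]
  exact finrank_zero_of_subsingleton

end TorsionBy

/-! ### Uniqueness and existence of the Jordan blocks -/

section JordanFamily

/-- The `ℝ[X]`-module of a block diagonal matrix whose blocks are the Jordan blocks in `f`. -/
abbrev JordanModule {ι : Type*} (f : ι → ℂ × ℕ) :=
  ∀ i, ℝ[X] ⧸ Ideal.span {elementaryDivisor (f i)}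

/-- The pairs `(l, c)` for which there is a Jordan block `J_c(l)`, each block counted once. -/
def IsJordanPair (b : ℂ × ℕ) : Prop :=
  0 ≤ b.1.im ∧ 1 ≤ b.2 ∧ (b.1.im ≠ 0 → Even b.2)

theorem elementaryDivisor_ne_zero (b : ℂ × ℕ) : elementaryDivisor b ≠ 0 :=
  pow_ne_zero _ (irreducible_minpoly b.1).ne_zero

instance finite_quotient_elementaryDivisor (b : ℂ × ℕ) :
    Module.Finite ℝ (ℝ[X] ⧸ Ideal.span {elementaryDivisor b}) :=
  finite_quotient_span (elementaryDivisor_ne_zero b)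

theorem IsJordanPair.one_le_jordanExponent {b : ℂ × ℕ} (hb : IsJordanPair b) :
    1 ≤ jordanExponent b := by
  obtain ⟨-, h1, h2⟩ := hb
  unfold jordanExponent
  split_ifs with h
  · exact h1
  · obtain ⟨a, ha⟩ := h2 h
    omega

theorem IsJordanPair.ext {b b' : ℂ × ℕ} (hb : IsJordanPair b) (hb' : IsJordanPair b')
    (h : b.1 = b'.1) (h' : jordanExponent b = jordanExponent b') : b = b' := by
  obtain ⟨-, -, h2⟩ := hb
  obtain ⟨-, -, h2'⟩ := hb'
  refine Prod.ext h ?_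
  unfold jordanExponent at h'
  rw [h] at h' h2
  split_ifs at h' with h0
  · exact h'
  · obtain ⟨a, ha⟩ := h2 h0
    obtain ⟨a', ha'⟩ := h2' h0
    omega

/-- Distinct eigenvalues in the closed upper half-plane have coprime minimal polynomials, so only
blocks with eigenvalue `l` contribute. -/
theorem finrank_torsionBy_elementaryDivisor {b : ℂ × ℕ} (hb : 0 ≤ b.1.im) {l : ℂ}
    (hl : 0 ≤ l.im) (k : ℕ) :
    finrank ℝ (Submodule.torsionBy ℝ[X] (ℝ[X] ⧸ Ideal.span {elementaryDivisor b})
      (minpoly ℝ l ^ k)) =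
      if b.1 = l then (minpoly ℝ l).natDegree * min k (jordanExponent b) else 0 := by
  split_ifs with h
  · subst h
    exact finrank_torsionBy_pow_quotient (irreducible_minpoly _) _ _
  · refine finrank_torsionBy_quotient_of_isCoprime (IsCoprime.pow ?_)
    refine ((irreducible_minpoly b.1).coprime_iff_not_dvd).mpr fun hdvd => h ?_
    refine eq_of_minpoly_eq ?_ hb hl
    exact eq_of_monic_of_associated (minpoly.monic (Algebra.IsIntegral.isIntegral _))
      (minpoly.monic (Algebra.IsIntegral.isIntegral _))
      ((irreducible_minpoly b.1).associated_of_dvd (irreducible_minpoly l) hdvd)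

variable {ι ι' : Type*} [Fintype ι] [Fintype ι']

open scoped Classical in
theorem finrank_torsionBy_jordanModule {f : ι → ℂ × ℕ} (hf : ∀ i, 0 ≤ (f i).1.im) {l : ℂ}
    (hl : 0 ≤ l.im) (k : ℕ) :
    finrank ℝ (Submodule.torsionBy ℝ[X] (JordanModule f) (minpoly ℝ l ^ k)) =
      ∑ i, if (f i).1 = l then (minpoly ℝ l).natDegree * min k (jordanExponent (f i)) else 0 := by
  rw [finrank_torsionBy_pi]
  refine Finset.sum_congr rfl fun i _ => ?_
  rw [finrank_torsionBy_elementaryDivisor (hf i) hl]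

theorem finrank_jordanModule {f : ι → ℂ × ℕ} (hf : ∀ i, IsJordanPair (f i)) :
    finrank ℝ (JordanModule f) = ∑ i, (f i).2 := by
  rw [finrank_pi_fintype]
  refine Finset.sum_congr rfl fun i _ => ?_
  rw [finrank_quotient_span_eq_natDegree, natDegree_elementaryDivisor (hf i).2.2]

open scoped Classical in
-- Raising the power by one enlarges the torsion of a block, by the degree of the minimal
-- polynomial, exactly when the exponent of the block exceeds `k`. These counts are therefore module
-- invariants.
theorem finrank_torsionBy_pow_succ {f : ι → ℂ × ℕ} (hf : ∀ i, 0 ≤ (f i).1.im) {l : ℂ}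
    (hl : 0 ≤ l.im) (k : ℕ) :
    finrank ℝ (Submodule.torsionBy ℝ[X] (JordanModule f) (minpoly ℝ l ^ (k + 1))) =
      finrank ℝ (Submodule.torsionBy ℝ[X] (JordanModule f) (minpoly ℝ l ^ k)) +
      (minpoly ℝ l).natDegree *
        (Finset.univ.filter fun i => (f i).1 = l ∧ k < jordanExponent (f i)).card := by
  rw [finrank_torsionBy_jordanModule hf hl, finrank_torsionBy_jordanModule hf hl,
    Finset.card_filter, Finset.mul_sum, ← Finset.sum_add_distrib]
  refine Finset.sum_congr rfl fun i _ => ?_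
  by_cases h : (f i).1 = l
  · by_cases h' : k < jordanExponent (f i)
    · rw [if_pos h, if_pos h, if_pos ⟨h, h'⟩, min_eq_left (by omega), min_eq_left (by omega)]
      ring
    · rw [if_pos h, if_pos h, if_neg (by tauto), min_eq_right (by omega),
        min_eq_right (by omega), mul_zero, add_zero]
  · rw [if_neg h, if_neg h, if_neg (by tauto), mul_zero, add_zero]

open scoped Classical in
theorem card_lt_jordanExponent_eq {f : ι → ℂ × ℕ} {g : ι' → ℂ × ℕ}
    (hf : ∀ i, 0 ≤ (f i).1.im) (hg : ∀ i, 0 ≤ (g i).1.im)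
    (e : JordanModule f ≃ₗ[ℝ[X]] JordanModule g) {l : ℂ} (hl : 0 ≤ l.im) (k : ℕ) :
    (Finset.univ.filter fun i => (f i).1 = l ∧ k < jordanExponent (f i)).card =
      (Finset.univ.filter fun i => (g i).1 = l ∧ k < jordanExponent (g i)).card := by
  have h1 := finrank_torsionBy_pow_succ hf hl k
  have h2 := finrank_torsionBy_pow_succ hg hl k
  rw [finrank_torsionBy_eq_of_equiv e, finrank_torsionBy_eq_of_equiv e, h2] at h1
  have hpos : 0 < (minpoly ℝ l).natDegree := (irreducible_minpoly l).natDegree_pos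
  exact (Nat.eq_of_mul_eq_mul_left hpos (Nat.add_left_cancel h1)).symm

open scoped Classical in
-- The multiplicity of a given block is the difference of two consecutive counts. The subtraction is
-- harmless because exponents of Jordan pairs are positive.
theorem card_lt_jordanExponent_eq_add {f : ι → ℂ × ℕ} (hf : ∀ i, IsJordanPair (f i))
    {b : ℂ × ℕ} (hb : IsJordanPair b) :
    (Finset.univ.filter fun i =>
        (f i).1 = b.1 ∧ jordanExponent b - 1 < jordanExponent (f i)).card =
      (Finset.univ.filter fun i =>
        (f i).1 = b.1 ∧ jordanExponent b < jordanExponent (f i)).card +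
      (Finset.univ.filter fun i => f i = b).card := by
  have hb1 := hb.one_le_jordanExponent
  rw [← Finset.card_union_of_disjoint]
  · congr 1
    ext i
    simp only [Finset.mem_filter, Finset.mem_univ, true_and, Finset.mem_union]
    constructor
    · rintro ⟨h1, h2⟩
      rcases eq_or_ne (jordanExponent (f i)) (jordanExponent b) with h3 | h3
      · exact Or.inr ((hf i).ext hb h1 h3)
      · exact Or.inl ⟨h1, by omega⟩
    · rintro (⟨h1, h2⟩ | h)
      · exact ⟨h1, by omega⟩
      · rw [h]
        exact ⟨rfl, by omega⟩
  · rw [Finset.disjoint_filter]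
    rintro i - ⟨-, h2⟩ h
    rw [h] at h2
    exact lt_irrefl _ h2

open scoped Classical in
/-- Isomorphic Jordan modules have the same Jordan blocks up to order. -/
theorem exists_equiv_of_jordanModule_equiv {f : ι → ℂ × ℕ} {g : ι' → ℂ × ℕ}
    (hf : ∀ i, IsJordanPair (f i)) (hg : ∀ i, IsJordanPair (g i))
    (e : JordanModule f ≃ₗ[ℝ[X]] JordanModule g) : ∃ σ : ι ≃ ι', ∀ i, g (σ i) = f i := by
  have hcard : ∀ b : ℂ × ℕ, (Finset.univ.filter fun i => f i = b).card =
      (Finset.univ.filter fun i => g i = b).card := by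
    intro b
    by_cases hb : IsJordanPair b
    · have h1 := card_lt_jordanExponent_eq_add hf hb
      have h2 := card_lt_jordanExponent_eq_add hg hb
      rw [card_lt_jordanExponent_eq (fun i => (hf i).1) (fun i => (hg i).1) e hb.1,
        card_lt_jordanExponent_eq (fun i => (hf i).1) (fun i => (hg i).1) e hb.1, h2] at h1
      exact (Nat.add_left_cancel h1).symm
    · have hf' : ∀ i, f i ≠ b := fun i h => hb (h ▸ hf i)
      have hg' : ∀ i, g i ≠ b := fun i h => hb (h ▸ hg i)
      simp [hf', hg']
  have hfib : ∀ b : ℂ × ℕ, Nonempty ({i // f i = b} ≃ {i // g i = b}) := fun b =>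
    ⟨Fintype.equivOfCardEq (by rw [Fintype.card_subtype, Fintype.card_subtype, hcard])⟩
  exact ⟨Equiv.ofFiberEquiv fun b => (hfib b).some, Equiv.ofFiberEquiv_map _⟩

theorem nonempty_jordanModule_equiv_of_equiv {ι ι' : Type*} {f : ι → ℂ × ℕ} {g : ι' → ℂ × ℕ}
    (σ : ι ≃ ι') (h : ∀ i, g (σ i) = f i) : Nonempty (JordanModule f ≃ₗ[ℝ[X]] JordanModule g) := by
  obtain rfl : (fun i => g (σ i)) = f := funext h
  exact ⟨LinearEquiv.piCongrLeft ℝ[X]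
    (fun i => ℝ[X] ⧸ Ideal.span {elementaryDivisor (g i)}) σ⟩

/-- Every real square matrix is described by a family of Jordan blocks. -/
theorem exists_polyModule_equiv_jordanModule {κ : Type} [Fintype κ] [DecidableEq κ]
    (A : Matrix κ κ ℝ) :
    ∃ (ι : Type) (_ : Fintype ι) (f : ι → ℂ × ℕ), (∀ i, IsJordanPair (f i)) ∧
      Nonempty (PolyModule A ≃ₗ[ℝ[X]] JordanModule f) := by
  classical
  have htors : Module.IsTorsion ℝ[X] (PolyModule A) :=
    AEval.isTorsion_of_finiteDimensional ℝ (κ → ℝ) (Matrix.toLin' A)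
  obtain ⟨ι, _, p, hp, e, ⟨φ⟩⟩ := Module.equiv_directSum_of_isTorsion htors
  choose l hl hpl using fun i => exists_associated_minpoly (hp i)
  -- Inverse to `jordanExponent`: a power `e` of a quadratic factor corresponds to a block of size
  -- `2e`.
  let c : ι → ℕ := fun i => if (l i).im = 0 then e i else 2 * e i
  have hexp : ∀ i, jordanExponent (l i, c i) = e i := by
    intro i
    by_cases h : (l i).im = 0 <;> simp [jordanExponent, c, h]
  have hspan : ∀ i, Submodule.span ℝ[X] {p i ^ e i} =
      Ideal.span {elementaryDivisor (l i, c i)} := by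
    intro i
    rw [elementaryDivisor, hexp]
    exact Ideal.span_singleton_eq_span_singleton.mpr ((hpl i).pow_pow)
  -- The structure theorem may return summands with exponent zero. They are trivial modules and are
  -- discarded, since blocks must have positive size.
  let f : {i // e i ≠ 0} → ℂ × ℕ := fun i => (l i, c i)
  let ψ : PolyModule A ≃ₗ[ℝ[X]] JordanModule fun i => (l i, c i) :=
    φ.trans ((DirectSum.linearEquivFunOnFintype ℝ[X] ι _).trans
      (LinearEquiv.piCongrRight fun i => Submodule.quotEquivOfEq _ _ (hspan i)))
  let χ : (JordanModule fun i => (l i, c i)) →ₗ[ℝ[X]] JordanModule f :=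
    LinearMap.pi fun i => LinearMap.proj i.1
  have hχ : Function.Bijective χ := by
    constructor
    · intro x y hxy
      funext i
      by_cases h : e i = 0
      · have : Subsingleton (ℝ[X] ⧸ Ideal.span {elementaryDivisor (l i, c i)}) := by
          rw [Ideal.Quotient.subsingleton_iff, Ideal.span_singleton_eq_top, elementaryDivisor,
            hexp, h, pow_zero]
          exact isUnit_one
        exact Subsingleton.elim _ _
      · exact congrFun hxy ⟨i, h⟩
    · intro y
      refine ⟨fun i => if h : e i ≠ 0 then y ⟨i, h⟩ else 0, ?_⟩
      funext i
      exact dif_pos i.2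
  refine ⟨{i // e i ≠ 0}, inferInstance, f, ?_, ⟨ψ.trans (LinearEquiv.ofBijective χ hχ)⟩⟩
  rintro ⟨i, hi⟩
  refine ⟨hl i, ?_, fun h => ?_⟩
  · simp only [f, c]
    split_ifs <;> omega
  · simp only [f, c]
    rw [if_neg h]
    exact even_two_mul _

end JordanFamily

end DualPair

namespace DualPair

open Polynomial Module

/-! ### Size and rank in terms of Jordan blocks -/

section Rank

theorem finrank_torsionBy_polyModule_add_rank {κ : Type*} [Fintype κ] [DecidableEq κ]
    (A : Matrix κ κ ℝ) :
    finrank ℝ (Submodule.torsionBy ℝ[X] (PolyModule A) X) + A.rank = Fintype.card κ := by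
  have h : (LinearMap.ker A.mulVecLin).map
      (AEval'.of (Matrix.toLin' A) : (κ → ℝ) →ₗ[ℝ] PolyModule A) =
      (Submodule.torsionBy ℝ[X] (PolyModule A) X).restrictScalars ℝ := by
    ext y
    obtain ⟨v, rfl⟩ := (AEval'.of (Matrix.toLin' A)).surjective y
    rw [Submodule.restrictScalars_mem, Submodule.mem_torsionBy_iff, AEval'.X_smul_of,
      LinearEquiv.map_eq_zero_iff, Submodule.mem_map]
    constructor
    · rintro ⟨w, hw, hwv⟩
      obtain rfl := (AEval'.of (Matrix.toLin' A)).injective hwv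
      exact hw
    · intro hv
      exact ⟨v, hv, rfl⟩
  have h1 : finrank ℝ (LinearMap.ker A.mulVecLin) =
      finrank ℝ (Submodule.torsionBy ℝ[X] (PolyModule A) X) :=
    ((AEval'.of (Matrix.toLin' A)).ofSubmodules _ _ h).finrank_eq
  rw [← h1, add_comm, Matrix.rank, LinearMap.finrank_range_add_finrank_ker,
    finrank_fintype_fun_eq_card]

open scoped Classical in
-- The kernel of `A` is the `X`-torsion, and `X` is the minimal polynomial of `0`; each block with
-- eigenvalue zero contributes one dimension.
theorem card_eq_zero_add_rank {κ ι : Type*} [Fintype κ] [DecidableEq κ] [Fintype ι]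
    {A : Matrix κ κ ℝ} {f : ι → ℂ × ℕ} (hf : ∀ i, IsJordanPair (f i))
    (e : PolyModule A ≃ₗ[ℝ[X]] JordanModule f) :
    (∑ i, if (f i).1 = 0 then 1 else 0) + A.rank = Fintype.card κ := by
  rw [← finrank_torsionBy_polyModule_add_rank, finrank_torsionBy_eq_of_equiv e]
  have h := finrank_torsionBy_jordanModule (fun i => (hf i).1) (l := 0) le_rfl 1
  rw [minpoly.zero, pow_one, natDegree_X] at h
  rw [h]
  congr 1
  refine Finset.sum_congr rfl fun i _ => ?_
  rw [min_eq_left (hf i).one_le_jordanExponent]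

theorem sum_snd_eq_card {κ ι : Type*} [Fintype κ] [DecidableEq κ] [Fintype ι]
    {A : Matrix κ κ ℝ} {f : ι → ℂ × ℕ} (hf : ∀ i, IsJordanPair (f i))
    (e : PolyModule A ≃ₗ[ℝ[X]] JordanModule f) : ∑ i, (f i).2 = Fintype.card κ := by
  rw [← finrank_jordanModule hf, ← (e.restrictScalars ℝ).finrank_eq,
    ← (AEval'.of (Matrix.toLin' A)).finrank_eq, finrank_fintype_fun_eq_card]

end Rank

/-! ### Block diagonal matrices and sorting of blocks -/

section Families

theorem nonempty_polyModule_blockDiagonal_equiv {p : ℕ} (l : Fin p → ℂ) (c : Fin p → ℕ)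
    (hc : ∀ i, 1 ≤ c i) (hl : ∀ i, (l i).im ≠ 0 → Even (c i)) :
    Nonempty (PolyModule (Matrix.blockDiagonal' fun i => realJordanBlock (c i) (l i)) ≃ₗ[ℝ[X]]
      JordanModule fun i => (l i, c i)) :=
  ⟨(polyModuleBlockDiagonal _).trans (LinearEquiv.piCongrRight fun i =>
    (nonempty_polyModule_realJordanBlock_equiv (hc i) (hl i)).some)⟩

theorem nonempty_polyModule_zero_equiv (r : ℕ) :
    Nonempty (PolyModule (0 : Matrix (Fin r) (Fin r) ℝ) ≃ₗ[ℝ[X]]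
      JordanModule fun _ : Fin r => ((0 : ℂ), 1)) := by
  obtain ⟨e⟩ := nonempty_polyModule_blockDiagonal_equiv (fun _ : Fin r => 0) (fun _ => 1)
    (fun _ => le_rfl) (fun _ h => absurd rfl h)
  let σ : (Σ _ : Fin r, Fin 1) ≃ Fin r := Equiv.sigmaUnique (Fin r) fun _ => Fin 1
  have h : (Matrix.blockDiagonal' fun _ : Fin r => realJordanBlock 1 0) = 0 := by
    have h0 : realJordanBlock 1 0 = 0 := by
      rw [realJordanBlock_of_im_eq_zero rfl, shift_eq_zero le_rfl]
      simp
    simp only [h0]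
    exact Matrix.blockDiagonal'_zero
  rw [h] at e
  exact ⟨(polyModuleReindex σ 0).trans e⟩

noncomputable def jordanModuleSum {α β : Type*} (f : α → ℂ × ℕ) (g : β → ℂ × ℕ) :
    JordanModule (Sum.elim f g) ≃ₗ[ℝ[X]] JordanModule f × JordanModule g :=
  LinearEquiv.sumPiEquivProdPi ℝ[X] α β
    fun i => ℝ[X] ⧸ Ideal.span {elementaryDivisor (Sum.elim f g i)}

/-- An equivalence of disjoint unions that respects the two parts splits. -/
theorem exists_equiv_of_sum_equiv {α α' β β' : Type*} (σ : α ⊕ β ≃ α' ⊕ β')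
    (hl : ∀ a, ∃ a', σ (Sum.inl a) = Sum.inl a') (hr : ∀ b, ∃ b', σ (Sum.inr b) = Sum.inr b') :
    (∃ s : α ≃ α', ∀ a, σ (Sum.inl a) = Sum.inl (s a)) ∧
      ∃ t : β ≃ β', ∀ b, σ (Sum.inr b) = Sum.inr (t b) := by
  choose s hs using hl
  choose t ht using hr
  constructor
  · refine ⟨Equiv.ofBijective s ⟨fun a b h => ?_, fun a' => ?_⟩, hs⟩
    · exact Sum.inl_injective (σ.injective (by rw [hs, hs, h]))
    · obtain ⟨a | b, h⟩ := σ.surjective (Sum.inl a')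
      · exact ⟨a, Sum.inl_injective ((hs a).symm.trans h)⟩
      · rw [ht] at h
        cases h
  · refine ⟨Equiv.ofBijective t ⟨fun a b h => ?_, fun b' => ?_⟩, ht⟩
    · exact Sum.inr_injective (σ.injective (by rw [ht, ht, h]))
    · obtain ⟨a | b, h⟩ := σ.surjective (Sum.inr b')
      · rw [hs] at h
        cases h
      · exact ⟨b, Sum.inr_injective ((ht b).symm.trans h)⟩

/-- A family of Jordan blocks is, up to order, made of blocks with a non-zero eigenvalue, nilpotent
blocks of size at least two, and zero blocks of size one. -/
theorem exists_sum_equiv_of_isJordanPair {ι : Type*} [Fintype ι] {f : ι → ℂ × ℕ}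
    (hf : ∀ i, IsJordanPair (f i)) :
    ∃ (p q r : ℕ) (b : Fin p → ℂ × ℕ) (d : Fin q → ℕ) (σ : Fin p ⊕ (Fin q ⊕ Fin r) ≃ ι),
      (∀ i, (b i).1 ≠ 0) ∧ (∀ j, 2 ≤ d j) ∧
        ∀ x, f (σ x) = Sum.elim b (Sum.elim (fun j => (0, d j)) fun _ => (0, 1)) x := by
  classical
  let P := {i // (f i).1 ≠ 0}
  let Q := {i // (f i).1 = 0 ∧ 2 ≤ (f i).2}
  let R := {i // (f i).1 = 0 ∧ (f i).2 = 1}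
  let v : P ⊕ (Q ⊕ R) → ι := Sum.elim Subtype.val (Sum.elim Subtype.val Subtype.val)
  have hv : Function.Bijective v := by
    constructor
    · rintro (⟨x, hx⟩ | ⟨x, hx⟩ | ⟨x, hx⟩) (⟨y, hy⟩ | ⟨y, hy⟩ | ⟨y, hy⟩) h <;>
        simp only [v, Sum.elim_inl, Sum.elim_inr] at h <;> subst h <;>
        first | rfl | exact absurd hx.1 hy | exact absurd hy.1 hx | omega
    · intro i
      by_cases h : (f i).1 = 0
      · by_cases h' : 2 ≤ (f i).2
        · exact ⟨Sum.inr (Sum.inl ⟨i, h, h'⟩), rfl⟩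
        · exact ⟨Sum.inr (Sum.inr ⟨i, h, by have := (hf i).2.1; omega⟩), rfl⟩
      · exact ⟨Sum.inl ⟨i, h⟩, rfl⟩
  let eP := (Fintype.equivFin P).symm
  let eQ := (Fintype.equivFin Q).symm
  let eR := (Fintype.equivFin R).symm
  refine ⟨_, _, _, fun i => f (eP i).1, fun j => (f (eQ j).1).2,
    (Equiv.sumCongr eP (Equiv.sumCongr eQ eR)).trans (Equiv.ofBijective v hv),
    fun i => (eP i).2, fun j => (eQ j).2.2, ?_⟩
  rintro (i | j | k)
  · rfl
  · exact Prod.ext (eQ j).2.1 rfl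
  · exact Prod.ext (eR k).2.1 (eR k).2.2

end Families

/-! ### Jordan data and the normal forms `zeta` and `xi` -/

namespace JordanData

variable {n m : ℕ}

def zetaFamily (D : JordanData n m) : Fin D.p ⊕ (Fin D.q ⊕ Fin (n - m - D.q)) → ℂ × ℕ :=
  Sum.elim (fun i => (D.lam i, D.c i)) (Sum.elim (fun j => (0, D.d j)) fun _ => (0, 1))

def xiFamily (D : JordanData n m) : Fin D.p ⊕ Fin D.q → ℂ × ℕ :=
  Sum.elim (fun i => (D.lam i, D.c i)) fun j => (0, D.d j - 1)

theorem isJordanPair_xiFamily (D : JordanData n m) (x : Fin D.p ⊕ Fin D.q) :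
    IsJordanPair (D.xiFamily x) := by
  rcases x with i | j
  · exact ⟨D.lam_im_nonneg i, D.one_le_c i, D.even_c_of_im_ne_zero i⟩
  · refine ⟨le_rfl, ?_, fun h => absurd rfl h⟩
    have := D.two_le_d j
    change 1 ≤ D.d j - 1
    omega

theorem nonempty_polyModule_zeta_equiv (D : JordanData n m) :
    Nonempty (PolyModule D.zeta ≃ₗ[ℝ[X]] JordanModule D.zetaFamily) := by
  obtain ⟨e₁⟩ := nonempty_polyModule_blockDiagonal_equiv D.lam D.c D.one_le_c
    D.even_c_of_im_ne_zero
  obtain ⟨e₂⟩ := nonempty_polyModule_blockDiagonal_equiv (fun _ => 0) D.d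
    (fun j => one_le_two.trans (D.two_le_d j)) (fun _ h => absurd rfl h)
  obtain ⟨e₃⟩ := nonempty_polyModule_zero_equiv (n - m - D.q)
  exact ⟨(polyModuleReindex D.zetaIndex _).trans ((polyModuleFromBlocks _ _).trans
    ((e₁.prodCongr ((polyModuleFromBlocks _ _).trans ((e₂.prodCongr e₃).trans
      (jordanModuleSum _ _).symm))).trans (jordanModuleSum _ _).symm))⟩

theorem nonempty_polyModule_xi_equiv (D : JordanData n m) :
    Nonempty (PolyModule D.xi ≃ₗ[ℝ[X]] JordanModule D.xiFamily) := by
  obtain ⟨e₁⟩ := nonempty_polyModule_blockDiagonal_equiv D.lam D.c D.one_le_c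
    D.even_c_of_im_ne_zero
  obtain ⟨e₂⟩ := nonempty_polyModule_blockDiagonal_equiv (fun _ => 0) (fun j => D.d j - 1)
    (fun j => by have := D.two_le_d j; omega) (fun _ h => absurd rfl h)
  exact ⟨(polyModuleReindex D.xiIndex _).trans ((polyModuleFromBlocks _ _).trans
    ((e₁.prodCongr e₂).trans (jordanModuleSum _ _).symm))⟩

theorem adjointOrbit_zeta_mem_orbitsIn (D : JordanData n m) :
    adjointOrbit D.zeta ∈ orbitsIn (imageL n m) := by
  rw [← D.jL_pair]
  exact adjointOrbit_jL_mem_orbitsIn D.pair_mem_fullRankPairs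

theorem adjointOrbit_xi_mem_orbitsIn (D : JordanData n m) :
    adjointOrbit D.xi ∈ orbitsIn (imageR n m) := by
  rw [← D.jR_pair]
  exact adjointOrbit_jR_mem_orbitsIn D.pair_mem_fullRankPairs

theorem orbitCorrespondence_adjointOrbit_zeta (D : JordanData n m) :
    orbitCorrespondence n m (adjointOrbit D.zeta) = adjointOrbit D.xi := by
  rw [← D.jL_pair, ← D.jR_pair]
  exact orbitCorrespondence_adjointOrbit_jL D.pair_mem_fullRankPairs

theorem adjointOrbit_zeta_eq_of_sameUpToOrder {D D' : JordanData n m} (h : D.SameUpToOrder D') :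
    adjointOrbit D.zeta = adjointOrbit D'.zeta := by
  obtain ⟨⟨σ, hσ⟩, τ, hτ⟩ := h
  have hq : D.q = D'.q := by simpa using Fintype.card_congr τ
  obtain ⟨e⟩ := nonempty_jordanModule_equiv_of_equiv (f := D.zetaFamily) (g := D'.zetaFamily)
    (Equiv.sumCongr σ (Equiv.sumCongr τ (finCongr (by rw [hq])))) (by
      rintro (i | j | k)
      · exact Prod.ext (hσ i).1 (hσ i).2
      · exact Prod.ext rfl (hτ j)
      · rfl)
  obtain ⟨e₁⟩ := D.nonempty_polyModule_zeta_equiv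
  obtain ⟨e₂⟩ := D'.nonempty_polyModule_zeta_equiv
  exact adjointOrbit_eq_iff.mpr (mem_adjointOrbit_iff_nonempty_equiv.mpr
    ⟨e₁.trans (e.trans e₂.symm)⟩)

/-- In `xi` the eigenvalue alone separates the two kinds of blocks, so a matching of all blocks
splits into one of the `(λ, c)` and one of the `d - 1`. As `d ≥ 2`, the number `d - 1` recovers `d`.
-/
theorem sameUpToOrder_of_adjointOrbit_xi_eq {D D' : JordanData n m}
    (h : adjointOrbit D.xi = adjointOrbit D'.xi) : D.SameUpToOrder D' := by
  obtain ⟨e⟩ := mem_adjointOrbit_iff_nonempty_equiv.mp (adjointOrbit_eq_iff.mp h)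
  obtain ⟨e₁⟩ := D.nonempty_polyModule_xi_equiv
  obtain ⟨e₂⟩ := D'.nonempty_polyModule_xi_equiv
  obtain ⟨σ, hσ⟩ := exists_equiv_of_jordanModule_equiv D.isJordanPair_xiFamily
    D'.isJordanPair_xiFamily (e₁.symm.trans (e.trans e₂))
  obtain ⟨⟨s, hs⟩, t, ht⟩ := exists_equiv_of_sum_equiv σ
    (fun i => by
      have h1 := congrArg Prod.fst (hσ (Sum.inl i))
      rcases h2 : σ (Sum.inl i) with i' | j'
      · exact ⟨i', rfl⟩
      · rw [h2] at h1
        exact absurd h1.symm (D.lam_ne_zero i))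
    (fun j => by
      have h1 := congrArg Prod.fst (hσ (Sum.inr j))
      rcases h2 : σ (Sum.inr j) with i' | j'
      · rw [h2] at h1
        exact absurd h1 (D'.lam_ne_zero i')
      · exact ⟨j', rfl⟩)
  refine ⟨⟨s, fun i => ?_⟩, t, fun j => ?_⟩
  · have h1 := hσ (Sum.inl i)
    rw [hs] at h1
    exact ⟨congrArg Prod.fst h1, congrArg Prod.snd h1⟩
  · have h1 := hσ (Sum.inr j)
    rw [ht] at h1
    have h2 : D'.d (t j) - 1 = D.d j - 1 := congrArg Prod.snd h1
    have := D.two_le_d j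
    have := D'.two_le_d (t j)
    omega

/-- The correspondence turns equality of the `zeta` orbits into equality of the `xi` orbits. -/
theorem sameUpToOrder_of_adjointOrbit_zeta_eq {D D' : JordanData n m}
    (h : adjointOrbit D.zeta = adjointOrbit D'.zeta) : D.SameUpToOrder D' := by
  apply sameUpToOrder_of_adjointOrbit_xi_eq
  rw [← orbitCorrespondence_adjointOrbit_zeta, h, orbitCorrespondence_adjointOrbit_zeta]

/-- Let the Jordan form have `q` nilpotent blocks of size at least two and `r` of size one. Rank `m`
gives `q + r = n - m`; subtracting this from the total size `n` yields `∑ c + ∑ (d - 1) = m`. All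
summands are at least one, whence `p ≤ m` and `q ≤ m`. -/
theorem exists_adjointOrbit_eq_zeta {X : Matrix (Fin n) (Fin n) ℝ}
    (hX : X.rank = m) : ∃ D : JordanData n m, adjointOrbit X = adjointOrbit D.zeta := by
  classical
  obtain ⟨ι, _, f, hf, ⟨e⟩⟩ := exists_polyModule_equiv_jordanModule X
  obtain ⟨p, q, r, b, d, σ, hb, hd, hσ⟩ := exists_sum_equiv_of_isJordanPair hf
  have hbJ : ∀ i, IsJordanPair (b i) := fun i => by
    have := hf (σ (Sum.inl i))
    rwa [hσ] at this
  have hsize := sum_snd_eq_card hf e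
  have hnull := card_eq_zero_add_rank hf e
  rw [← σ.sum_comp, Fintype.card_fin] at hsize hnull
  simp only [hσ, Fintype.sum_sum_type, Sum.elim_inl, Sum.elim_inr, if_true, hb, if_false,
    Finset.sum_const_zero, Finset.sum_const, Finset.card_univ, Fintype.card_fin, smul_eq_mul,
    mul_one, zero_add, hX] at hsize hnull
  have hdsum : ∑ j, d j = ∑ j, (d j - 1) + q := by
    have h : ∑ j, d j = ∑ j, ((d j - 1) + 1) :=
      Finset.sum_congr rfl fun j _ => by have := hd j; omega
    rw [h, Finset.sum_add_distrib]
    simp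
  have hp : p ≤ ∑ i, (b i).2 := by
    simpa using Finset.card_nsmul_le_sum Finset.univ (fun i => (b i).2) 1 fun i _ => (hbJ i).2.1
  have hq : q ≤ ∑ j, (d j - 1) := by
    simpa using Finset.card_nsmul_le_sum Finset.univ (fun j => d j - 1) 1
      fun j _ => by have := hd j; omega
  let D : JordanData n m :=
    { p := p
      q := q
      lam := fun i => (b i).1
      c := fun i => (b i).2
      d := d
      p_le := by omega
      q_le := by omega
      lam_ne_zero := hb
      lam_im_nonneg := fun i => (hbJ i).1
      one_le_c := fun i => (hbJ i).2.1
      even_c := fun i h => (hbJ i).2.2 h.ne'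
      two_le_d := hd
      sum_eq := by omega }
  have hr : n - m - D.q = r := by
    change n - m - q = r
    omega
  obtain ⟨e'⟩ := nonempty_jordanModule_equiv_of_equiv (f := D.zetaFamily) (g := f)
    ((Equiv.sumCongr (Equiv.refl _) (Equiv.sumCongr (Equiv.refl _) (finCongr hr))).trans σ) (by
      rintro (i | j | k) <;> exact hσ _)
  obtain ⟨e₁⟩ := D.nonempty_polyModule_zeta_equiv
  exact ⟨D, adjointOrbit_eq_iff.mpr (mem_adjointOrbit_iff_nonempty_equiv.mpr
    ⟨e.trans (e'.symm.trans e₁.symm)⟩)⟩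

end JordanData

/-! ### Exhaustion of the orbits and bijectivity -/

section Orbits

variable {n m : ℕ}

theorem exists_jL_of_mem_orbitsIn {O : Set (Matrix (Fin n) (Fin n) ℝ)}
    (hO : O ∈ orbitsIn (imageL n m)) : ∃ x ∈ fullRankPairs n m, O = adjointOrbit (jL x) := by
  obtain ⟨⟨X, rfl⟩, hX⟩ := hO
  obtain ⟨x, hx, rfl⟩ := hX (self_mem_adjointOrbit X)
  exact ⟨x, hx, rfl⟩

theorem exists_jR_of_mem_orbitsIn {O : Set (Matrix (Fin m) (Fin m) ℝ)}
    (hO : O ∈ orbitsIn (imageR n m)) : ∃ x ∈ fullRankPairs n m, O = adjointOrbit (jR x) := by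
  obtain ⟨⟨X, rfl⟩, hX⟩ := hO
  obtain ⟨x, hx, rfl⟩ := hX (self_mem_adjointOrbit X)
  exact ⟨x, hx, rfl⟩

theorem exists_zeta_of_mem_orbitsIn {O : Set (Matrix (Fin n) (Fin n) ℝ)}
    (hO : O ∈ orbitsIn (imageL n m)) : ∃ D : JordanData n m, O = adjointOrbit D.zeta := by
  obtain ⟨x, hx, rfl⟩ := exists_jL_of_mem_orbitsIn hO
  exact JordanData.exists_adjointOrbit_eq_zeta (rank_of_mem_imageL ⟨x, hx, rfl⟩)

/-- The datum is found on the left, from the left momentum of the same pair, and transported by the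
correspondence. -/
theorem exists_xi_of_mem_orbitsIn {O : Set (Matrix (Fin m) (Fin m) ℝ)}
    (hO : O ∈ orbitsIn (imageR n m)) : ∃ D : JordanData n m, O = adjointOrbit D.xi := by
  obtain ⟨x, hx, rfl⟩ := exists_jR_of_mem_orbitsIn hO
  obtain ⟨D, hD⟩ := exists_zeta_of_mem_orbitsIn (adjointOrbit_jL_mem_orbitsIn hx)
  refine ⟨D, ?_⟩
  rw [← orbitCorrespondence_adjointOrbit_jL hx, hD,
    JordanData.orbitCorrespondence_adjointOrbit_zeta]

theorem bijOn_orbitCorrespondence :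
    Set.BijOn (orbitCorrespondence n m) (orbitsIn (imageL n m)) (orbitsIn (imageR n m)) := by
  refine ⟨fun O hO => ?_, fun O hO O' hO' h => ?_, fun O hO => ?_⟩
  · obtain ⟨x, hx, rfl⟩ := exists_jL_of_mem_orbitsIn hO
    rw [orbitCorrespondence_adjointOrbit_jL hx]
    exact adjointOrbit_jR_mem_orbitsIn hx
  -- Injectivity passes through the data: equal `xi` orbits force equal data up to order, and these
  -- force equal `zeta` orbits.
  · obtain ⟨D, rfl⟩ := exists_zeta_of_mem_orbitsIn hO
    obtain ⟨D', rfl⟩ := exists_zeta_of_mem_orbitsIn hO'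
    rw [JordanData.orbitCorrespondence_adjointOrbit_zeta,
      JordanData.orbitCorrespondence_adjointOrbit_zeta] at h
    exact JordanData.adjointOrbit_zeta_eq_of_sameUpToOrder
      (JordanData.sameUpToOrder_of_adjointOrbit_xi_eq h)
  · obtain ⟨x, hx, rfl⟩ := exists_jR_of_mem_orbitsIn hO
    exact ⟨_, adjointOrbit_jL_mem_orbitsIn hx, orbitCorrespondence_adjointOrbit_jL hx⟩

end Orbits

end DualPair

theorem mainTheorem9 (n m : ℕ) (hmn : m ≤ n) :
    -- orbits in the image of `j_L` are parametrized by Jordan data up to order, through `zeta`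
    ((∀ D : DualPair.JordanData n m,
        DualPair.adjointOrbit D.zeta ∈ DualPair.orbitsIn (DualPair.imageL n m)) ∧
      (∀ O ∈ DualPair.orbitsIn (DualPair.imageL n m),
        ∃ D : DualPair.JordanData n m, O = DualPair.adjointOrbit D.zeta) ∧
      (∀ D D' : DualPair.JordanData n m,
        DualPair.adjointOrbit D.zeta = DualPair.adjointOrbit D'.zeta ↔ D.SameUpToOrder D')) ∧
    -- orbits in the image of `j_R` are parametrized by Jordan data up to order, through `xi`
    ((∀ D : DualPair.JordanData n m,
        DualPair.adjointOrbit D.xi ∈ DualPair.orbitsIn (DualPair.imageR n m)) ∧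
      (∀ O ∈ DualPair.orbitsIn (DualPair.imageR n m),
        ∃ D : DualPair.JordanData n m, O = DualPair.adjointOrbit D.xi) ∧
      (∀ D D' : DualPair.JordanData n m,
        DualPair.adjointOrbit D.xi = DualPair.adjointOrbit D'.xi ↔ D.SameUpToOrder D')) ∧
    -- the images are unions of adjoint orbits
    ((∀ X ∈ DualPair.imageL n m,
        DualPair.adjointOrbit X ∈ DualPair.orbitsIn (DualPair.imageL n m)) ∧
      (∀ X ∈ DualPair.imageR n m,
        DualPair.adjointOrbit X ∈ DualPair.orbitsIn (DualPair.imageR n m))) ∧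
    -- the correspondence is one-to-one, and matches the orbits as described
    (Set.BijOn (DualPair.orbitCorrespondence n m)
        (DualPair.orbitsIn (DualPair.imageL n m)) (DualPair.orbitsIn (DualPair.imageR n m)) ∧
      (∀ x ∈ DualPair.fullRankPairs n m,
        DualPair.orbitCorrespondence n m (DualPair.adjointOrbit (DualPair.jL x)) =
          DualPair.adjointOrbit (DualPair.jR x)) ∧
      (∀ D : DualPair.JordanData n m,
        DualPair.orbitCorrespondence n m (DualPair.adjointOrbit D.zeta) =
          DualPair.adjointOrbit D.xi)) := by
  refine ⟨⟨fun D => D.adjointOrbit_zeta_mem_orbitsIn,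
      fun O hO => DualPair.exists_zeta_of_mem_orbitsIn hO, fun D D' =>
        ⟨DualPair.JordanData.sameUpToOrder_of_adjointOrbit_zeta_eq,
          DualPair.JordanData.adjointOrbit_zeta_eq_of_sameUpToOrder⟩⟩,
    ⟨fun D => D.adjointOrbit_xi_mem_orbitsIn,
      fun O hO => DualPair.exists_xi_of_mem_orbitsIn hO, fun D D' =>
        ⟨DualPair.JordanData.sameUpToOrder_of_adjointOrbit_xi_eq, fun h => ?_⟩⟩,
    ⟨?_, ?_⟩, DualPair.bijOn_orbitCorrespondence,
    fun x hx => DualPair.orbitCorrespondence_adjointOrbit_jL hx,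
    fun D => D.orbitCorrespondence_adjointOrbit_zeta⟩
  -- Invariance of the `xi` orbit under reordering follows from that of the `zeta` orbit, of which
  -- it is the image.
  · rw [← D.orbitCorrespondence_adjointOrbit_zeta, ← D'.orbitCorrespondence_adjointOrbit_zeta,
      DualPair.JordanData.adjointOrbit_zeta_eq_of_sameUpToOrder h]
  · rintro _ ⟨x, hx, rfl⟩
    exact DualPair.adjointOrbit_jL_mem_orbitsIn hx
  · rintro _ ⟨x, hx, rfl⟩
    exact DualPair.adjointOrbit_jR_mem_orbitsIn hx
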